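/- Let $n\ge 0$ be an integer and let $\mathcal K_n$ be the set of convex bodies in $\mathbb R^n$ (compact convex sets with nonempty interior), with the Hausdorff metric. An affine invariant point is a continuous map $p:\mathcal K_n\to\mathbb R^n$ with $p(T(K))=T(p(K))$ for every $K\in\mathcal K_n$ and every nonsingular affine map $T:\mathbb R^n\to\mathbb R^n$; it is proper if $p(K)\in\operatorname{int}(K)$ for every $K\in\mathcal K_n$. For $x\in\operatorname{int}(K)$ let $K^x=\{y\in\mathbb R^n:\langle y-x,a-x\rangle\le 1\text{ for every }a\in K\}\in\mathcal K_n$ be the polar of $K$ with respect to $x$. If $p$ is a proper affine invariant point, an affine invariant point $q$ is called a dual of $p$ if $q(K^{p(K)})=p(K)$ for every $K\in\mathcal K_n$; if $p$ has exactly one dual, it is denoted by $p^\circ$. An ellipsoid with center $c$ is a set $c+T(B)$, where $B$ is the closed Euclidean unit ball and $T$ is an invertible linear map of $\mathbb R^n$. Theorem. Every $K\in\mathcal K_n$ contains exactly one ellipsoid of maximal volume (the John ellipsoid) and is contained in exactly one ellipsoid of minimal volume (the Löwner ellipsoid). Denote their (uniquely determined) centers by $j(K)$ and $l(K)$. Then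 $j$ and $l$ are affine invariant points, $j$ is proper, and $l=j^\circ$; that is, $l(K^{j(K)})=j(K)$ for every $K\in\mathcal K_n$, and $l$ is the only dual of $j$. -/

import Mathlib

namespace AffInv

/-- Euclidean space `ℝⁿ`. -/
abbrev Space (n : ℕ) : Type := EuclideanSpace ℝ (Fin n)

/-- The space of convex bodies of `ℝⁿ` (compact convex sets with nonempty interior). As a subtype
of `ConvexBody` it carries the Hausdorff metric and the topology of that metric. -/
abbrev Body (n : ℕ) : Type :=
  {K : ConvexBody (Space n) // (interior (K : Set (Space n))).Nonempty}

/-- The underlying point set of a convex body. -/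
def Body.toSet {n : ℕ} (K : Body n) : Set (Space n) := (K.1 : Set (Space n))

/-- The image `T(K)` of a convex body under a nonsingular affine map. -/
def Body.image {n : ℕ} (T : Space n ≃ᵃ[ℝ] Space n) (K : Body n) : Body n :=
  ⟨{ carrier := T '' K.toSet
     convex' := K.1.convex.affine_image T.toAffineMap
     isCompact' := K.1.isCompact.image T.toContinuousAffineEquiv.continuous
     nonempty' := K.1.nonempty.image T }, by
    have h : interior (T '' K.toSet) = T '' interior K.toSet :=
      (T.toContinuousAffineEquiv.toHomeomorph.image_interior K.toSet).symm
    change (interior (T '' K.toSet)).Nonempty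
    rw [h]
    exact K.2.image T⟩

/-- The polar `A^x = {y : ⟨y - x, a - x⟩ ≤ 1 for every a ∈ A}` of a set with respect to `x`. -/
def polarSet {n : ℕ} (A : Set (Space n)) (x : Space n) : Set (Space n) :=
  {y | ∀ a ∈ A, inner ℝ (y - x) (a - x) ≤ 1}

theorem convex_polarSet {n : ℕ} (A : Set (Space n)) (x : Space n) :
    Convex ℝ (polarSet A x) := by
  intro y hy z hz s t hs ht hst a ha
  have h : s • y + t • z - x = s • (y - x) + t • (z - x) := by
    have hx : x = s • x + t • x := by rw [← add_smul, hst, one_smul]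
    nth_rewrite 1 [hx]
    module
  rw [h, inner_add_left, real_inner_smul_left, real_inner_smul_left]
  nlinarith [mul_le_mul_of_nonneg_left (hy a ha) hs, mul_le_mul_of_nonneg_left (hz a ha) ht]

theorem isClosed_polarSet {n : ℕ} (A : Set (Space n)) (x : Space n) :
    IsClosed (polarSet A x) := by
  have h : polarSet A x = ⋂ a ∈ A, {y | inner ℝ (y - x) (a - x) ≤ 1} := by
    ext y
    simp [polarSet]
  rw [h]
  exact isClosed_biInter fun a _ => isClosed_le (by fun_prop) continuous_const

theorem isCompact_polarSet {n : ℕ} {A : Set (Space n)} {x : Space n} (hx : x ∈ interior A) :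
    IsCompact (polarSet A x) := by
  obtain ⟨r, hr, hball⟩ := Metric.nhds_basis_closedBall.mem_iff.1 (mem_interior_iff_mem_nhds.1 hx)
  refine (isCompact_closedBall x r⁻¹).of_isClosed_subset (isClosed_polarSet A x) ?_
  intro y hy
  rw [mem_closedBall_iff_norm]
  rcases eq_or_ne (y - x) 0 with h0 | h0
  · rw [h0, norm_zero]
    positivity
  have hpos : 0 < ‖y - x‖ := norm_pos_iff.2 h0
  have hmem : x + (r * ‖y - x‖⁻¹) • (y - x) ∈ A := by
    apply hball
    rw [mem_closedBall_iff_norm, add_sub_cancel_left, norm_smul, Real.norm_of_nonneg (by positivity),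
      mul_assoc, inv_mul_cancel₀ hpos.ne', mul_one]
  have h := hy _ hmem
  rw [add_sub_cancel_left, real_inner_smul_right, real_inner_self_eq_norm_sq] at h
  have h2 : r * ‖y - x‖⁻¹ * ‖y - x‖ ^ 2 = r * ‖y - x‖ := by field_simp
  rw [h2] at h
  rwa [← one_div, le_div_iff₀' hr]

theorem mem_interior_polarSet {n : ℕ} {A : Set (Space n)} (hA : Bornology.IsBounded A)
    (x : Space n) : x ∈ interior (polarSet A x) := by
  obtain ⟨R, hR, hsub⟩ := hA.subset_closedBall_lt 0 x
  rw [mem_interior_iff_mem_nhds]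
  refine Filter.mem_of_superset (Metric.closedBall_mem_nhds x (inv_pos.2 hR)) ?_
  intro y hy a ha
  have h1 := mem_closedBall_iff_norm.1 hy
  have h2 := mem_closedBall_iff_norm.1 (hsub ha)
  calc inner ℝ (y - x) (a - x) ≤ ‖y - x‖ * ‖a - x‖ := real_inner_le_norm _ _
    _ ≤ R⁻¹ * R := by gcongr
    _ = 1 := inv_mul_cancel₀ hR.ne'

/-- The polar body `K^x` of a convex body with respect to an interior point `x`. -/
def Body.polar {n : ℕ} (K : Body n) (x : Space n) (hx : x ∈ interior K.toSet) : Body n :=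
  ⟨{ carrier := polarSet K.toSet x
     convex' := convex_polarSet _ _
     isCompact' := isCompact_polarSet hx
     nonempty' := ⟨x, interior_subset (mem_interior_polarSet K.1.isBounded x)⟩ },
    ⟨x, mem_interior_polarSet K.1.isBounded x⟩⟩

/-- `p` is an affine invariant point: it is continuous for the Hausdorff metric, and
`p(T(K)) = T(p(K))` for every nonsingular affine map `T`. -/
def IsAffineInvariantPoint {n : ℕ} (p : Body n → Space n) : Prop :=
  Continuous p ∧ ∀ (T : Space n ≃ᵃ[ℝ] Space n) (K : Body n), p (K.image T) = T (p K)

/-- `p` is proper: `p(K)` is always an interior point of `K`. -/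
def IsProper {n : ℕ} (p : Body n → Space n) : Prop :=
  ∀ K : Body n, p K ∈ interior K.toSet

/-- `q` is a dual of `p`: `p` is a proper affine invariant point, `q` is an affine invariant point,
and `q(K^{p(K)}) = p(K)` for every convex body `K`. -/
def IsDual {n : ℕ} (q p : Body n → Space n) : Prop :=
  IsAffineInvariantPoint p ∧ IsAffineInvariantPoint q ∧
    ∃ hp : IsProper p, ∀ K : Body n, q (K.polar (p K) (hp K)) = p K

/-- `E` is an ellipsoid with center `c`: `E = c + T(B)` for a linear bijection `T` of `ℝⁿ`, where
`B` is the closed Euclidean unit ball. -/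
def IsEllipsoidWithCenter {n : ℕ} (E : Set (Space n)) (c : Space n) : Prop :=
  ∃ T : Space n ≃ₗ[ℝ] Space n, E = (fun y => c + T y) '' Metric.closedBall 0 1

/-- `E` is an ellipsoid. -/
def IsEllipsoid {n : ℕ} (E : Set (Space n)) : Prop :=
  ∃ c, IsEllipsoidWithCenter E c

/-- `E` is an ellipsoid of maximal volume contained in `K`. -/
def IsJohnEllipsoid {n : ℕ} (K : Body n) (E : Set (Space n)) : Prop :=
  IsEllipsoid E ∧ E ⊆ K.toSet ∧
    ∀ F, IsEllipsoid F → F ⊆ K.toSet → MeasureTheory.volume F ≤ MeasureTheory.volume E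

/-- `E` is an ellipsoid of minimal volume containing `K`. -/
def IsLoewnerEllipsoid {n : ℕ} (K : Body n) (E : Set (Space n)) : Prop :=
  IsEllipsoid E ∧ K.toSet ⊆ E ∧
    ∀ F, IsEllipsoid F → K.toSet ⊆ F → MeasureTheory.volume E ≤ MeasureTheory.volume F

/-- `x` is the center of an ellipsoid of maximal volume contained in `K`. -/
def IsJohnPoint {n : ℕ} (K : Body n) (x : Space n) : Prop :=
  ∃ E, IsJohnEllipsoid K E ∧ IsEllipsoidWithCenter E x

/-- `x` is the center of an ellipsoid of minimal volume containing `K`. -/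
def IsLoewnerPoint {n : ℕ} (K : Body n) (x : Space n) : Prop :=
  ∃ E, IsLoewnerEllipsoid K E ∧ IsEllipsoidWithCenter E x

/-- The John point `j(K)`: the center of the ellipsoid of maximal volume contained in `K`. -/
noncomputable def johnPoint {n : ℕ} (K : Body n) : Space n :=
  Classical.epsilon (IsJohnPoint K)

/-- The Löwner point `l(K)`: the center of the ellipsoid of minimal volume containing `K`. -/
noncomputable def loewnerPoint {n : ℕ} (K : Body n) : Space n :=
  Classical.epsilon (IsLoewnerPoint K)

end AffInv

/-!
An ellipsoid is the image of the unit ball `B` under an affine map `φ`, with volume proportional to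
`|det φ|`, and also the preimage of `B` under an affine map, with volume proportional to
`|det φ|⁻¹`. So the John ellipsoid of `K` comes from an affine map `B → K`, and the Löwner ellipsoid
from an affine map `K → B`, of maximal absolute determinant (`IsMaxAffine`). The affine maps from a
set with interior points into a compact set form a compact set, so maximizers exist.

*Uniqueness.* Up to an isometry, two maximizers differ by a positive diagonal operator
(`exists_norm_eq_norm_diagOp`) of determinant one. Averaging it with the identity gives a
competitor, and strict log-concavity of the determinant forces the operator to be the
identity. Distinct centers would leave room for a stretched ellipsoid (John), or for a smaller ball
around the intersection of two unit balls (Löwner).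

*Continuity.* Hausdorff convergence of convex bodies amounts to mutual inclusions after homotheties
with ratios tending to one (`Body.homotheticLimit`). Conjugating affine maps by such homotheties
shows that limits of maximizers are maximizers (`IsMaxAffine.of_tendsto`); with compactness and
uniqueness this gives continuity of both centers.

*Duality.* The polar, with respect to the origin, of the unit ball with center `c`, where `‖c‖ < 1`,
contains a unit ball and is contained in a ball of radius `(1 - ‖c‖²)⁻¹`. By the first inclusion
and the bipolar theorem, an ellipsoid containing `K^{j(K)}` smaller than the polar of the John
ellipsoid would give an ellipsoid in `K` larger than the John ellipsoid
(`IsMaxAffine.polar_of_john`), so `l(K^{j(K)}) = j(K)`. By the second, if `B` is the Löwner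
ellipsoid of `L`, the polar of `L` contains no ellipsoid larger than `B`
(`IsMaxAffine.abs_det_le_one`). This last fact shows that `l(L)` is an interior point
of `L`, and that `j(L^{l(L)}) = l(L)`. Hence every body `L` has the form `K^{j(K)}`, with
`K = L^{l(L)}`, and a dual of `j` is determined by `j`.
-/

namespace AffInv

open Metric Set Filter Topology MeasureTheory

/-! ### Diagonal operators and the modulus of an operator -/

section Diagonal

variable {n : ℕ} (b : OrthonormalBasis (Fin n) ℝ (Space n)) (d : Fin n → ℝ)

/-- The operator that is diagonal in the orthonormal basis `b`, with diagonal entries `d`. -/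
noncomputable def diagOp : Space n →L[ℝ] Space n :=
  (Matrix.toLin b.toBasis b.toBasis (Matrix.diagonal d)).toContinuousLinearMap

theorem repr_diagOp (z : Space n) (i : Fin n) :
    b.repr (diagOp b d z) i = d i * b.repr z i := by
  have h := congrFun (Matrix.repr_toLin b.toBasis b.toBasis (Matrix.diagonal d) z) i
  simpa [diagOp, Matrix.mulVec_diagonal] using h

theorem det_diagOp : (diagOp b d).det = ∏ i, d i := by
  simp [diagOp, ContinuousLinearMap.det, LinearMap.det_toLin, Matrix.det_diagonal]

theorem norm_sq_diagOp (z : Space n) : ‖diagOp b d z‖ ^ 2 = ∑ i, (d i * b.repr z i) ^ 2 := by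
  rw [← b.repr.norm_map, EuclideanSpace.real_norm_sq_eq]
  simp [repr_diagOp]

theorem inner_diagOp_self (z : Space n) :
    inner ℝ (diagOp b d z) z = ∑ i, d i * b.repr z i ^ 2 := by
  rw [← b.repr.inner_map_map, PiLp.inner_apply]
  refine Finset.sum_congr rfl fun i _ => ?_
  rw [repr_diagOp]
  simp
  ring

theorem diagOp_one_sub_add (t : ℝ) (z : Space n) :
    diagOp b (fun i => (1 - t) + t * d i) z = (1 - t) • z + t • diagOp b d z := by
  apply b.repr.injective
  ext i
  simp [repr_diagOp]
  ring

theorem diagOp_one (z : Space n) : diagOp b (fun _ => 1) z = z := by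
  apply b.repr.injective
  ext i
  simp [repr_diagOp]

theorem diagOp_inv_diagOp (hd : ∀ i, 0 < d i) (z : Space n) :
    diagOp b d (diagOp b (fun i => (d i)⁻¹) z) = z := by
  apply b.repr.injective
  ext i
  simp [repr_diagOp, (hd i).ne']

/-- The modulus of a nonsingular operator: up to an isometry applied afterwards, `S` is a positive
diagonal operator in an orthonormal eigenbasis of `S* S`. -/
theorem exists_norm_eq_norm_diagOp {n : ℕ} (S : Space n →L[ℝ] Space n) (hS : S.det ≠ 0) :
    ∃ (b : OrthonormalBasis (Fin n) ℝ (Space n)) (d : Fin n → ℝ), (∀ i, 0 < d i) ∧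
      (∀ z, ‖S z‖ = ‖diagOp b d z‖) ∧ ∏ i, d i = |S.det| := by
  set A : Space n →L[ℝ] Space n := (ContinuousLinearMap.adjoint S) ∘L S with hA
  have hAi : ∀ x y, inner ℝ (A x) y = inner ℝ (S x) (S y) := fun x y => by
    simp [hA, ContinuousLinearMap.adjoint_inner_left]
  have hsym : (A : Space n →ₗ[ℝ] Space n).IsSymmetric := fun x y => by
    simp only [ContinuousLinearMap.coe_coe]
    rw [hAi, real_inner_comm (A y) x, hAi, real_inner_comm]
  have hn : Module.finrank ℝ (Space n) = n := by simp
  have hinj : Function.Injective S := (S.toContinuousLinearEquivOfDetNeZero hS).injective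
  set b := hsym.eigenvectorBasis hn
  set μ := hsym.eigenvalues hn
  have happ : ∀ i, A (b i) = μ i • b i := fun i => by
    exact hsym.apply_eigenvectorBasis hn i
  have horth : ∀ i j, inner ℝ (S (b i)) (S (b j)) = if i = j then μ i else 0 := fun i j => by
    rw [← hAi, happ, real_inner_smul_left, orthonormal_iff_ite.1 b.orthonormal]
    simp
  have hμ : ∀ i, μ i = ‖S (b i)‖ ^ 2 := fun i => by
    rw [← real_inner_self_eq_norm_sq, horth, if_pos rfl]
  have hpos : ∀ i, 0 < ‖S (b i)‖ := fun i => by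
    rw [norm_pos_iff, map_ne_zero_iff S hinj]
    exact b.orthonormal.ne_zero i
  refine ⟨b, fun i => ‖S (b i)‖, hpos, fun z => ?_, ?_⟩
  · rw [← sq_eq_sq₀ (norm_nonneg _) (norm_nonneg _), norm_sq_diagOp, ← real_inner_self_eq_norm_sq,
      ← hAi]
    have hz : A z = diagOp b μ z := by
      conv_lhs => rw [← b.sum_repr z]
      apply b.repr.injective
      ext i
      simp [repr_diagOp, happ, b.repr_self, Finset.sum_apply, Pi.single_apply, mul_comm]
    rw [hz, inner_diagOp_self]
    exact Finset.sum_congr rfl fun i _ => by rw [hμ, mul_pow]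
  · have h1 : (A : Space n →ₗ[ℝ] Space n).det = ∏ i, μ i := by
      simpa using hsym.det_eq_prod_eigenvalues hn
    have h2 := S.normDet_sq
    rw [LinearMap.normDet_eq_abs_det] at h2
    rw [← sq_eq_sq₀ (Finset.prod_nonneg fun i _ => (hpos i).le) (abs_nonneg _), ← Finset.prod_pow]
    simp_rw [← hμ]
    rw [← h1]
    exact_mod_cast h2.symm

theorem det_adjoint {n : ℕ} (S : Space n →L[ℝ] Space n) :
    (ContinuousLinearMap.adjoint S).det = S.det := by
  let b := EuclideanSpace.basisFun (Fin n) ℝ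
  rw [ContinuousLinearMap.det, ContinuousLinearMap.det, ← ContinuousLinearMap.adjoint_toLinearMap,
    ← LinearMap.det_toMatrix b.toBasis, LinearMap.toMatrix_adjoint, Matrix.det_conjTranspose,
    LinearMap.det_toMatrix]
  simp

/-- The rank-one perturbation `u ↦ u + δ ⟨v, u⟩ v` of the identity. -/
noncomputable def stretch {n : ℕ} (δ : ℝ) (v : Space n) : Space n →L[ℝ] Space n :=
  ContinuousLinearMap.id ℝ _ + δ • (innerSL ℝ v).smulRight v

theorem stretch_apply {n : ℕ} (δ : ℝ) (v u : Space n) :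
    stretch δ v u = u + (δ * inner ℝ v u) • v := by
  simp [stretch, smul_smul]

theorem det_stretch {n : ℕ} (δ : ℝ) (v : Space n) : (stretch δ v).det = 1 + δ * ‖v‖ ^ 2 := by
  have h : (stretch δ v : Space n →ₗ[ℝ] Space n) =
      LinearMap.transvection (δ • (innerSL ℝ v : Space n →ₗ[ℝ] ℝ)) v := by
    ext1 u
    simp [stretch_apply, LinearMap.transvection.apply]
  rw [ContinuousLinearMap.det, h, LinearMap.transvection.det]
  simp

end Diagonal

/-! ### Affine maps of maximal determinant -/

section MaxAffine

variable {n : ℕ}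

/-- `x ↦ T x + c` maps `X` into `Y`, and no affine map of `X` into `Y` has a larger absolute
determinant. With `X` the unit ball this describes the John ellipsoid of `Y`, which is the image of
the ball; with `Y` the unit ball it describes the Löwner ellipsoid of `X`, which is the preimage of
the ball. -/
structure IsMaxAffine (X Y : Set (Space n)) (T : Space n →L[ℝ] Space n) (c : Space n) : Prop where
  mapsTo : ∀ x ∈ X, T x + c ∈ Y
  abs_det_le : ∀ (T' : Space n →L[ℝ] Space n) (c' : Space n), (∀ x ∈ X, T' x + c' ∈ Y) →
    |T'.det| ≤ |T.det|

theorem det_smul_eq (s : ℝ) (T : Space n →L[ℝ] Space n) : (s • T).det = s ^ n * T.det := by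
  simp [ContinuousLinearMap.det, LinearMap.det_smul]

theorem det_comp_eq (S T : Space n →L[ℝ] Space n) : (S ∘L T).det = S.det * T.det := by
  simp [ContinuousLinearMap.det, LinearMap.det_comp]

theorem det_equiv_ne_zero (A : Space n ≃L[ℝ] Space n) :
    (A : Space n →L[ℝ] Space n).det ≠ 0 := by
  exact A.toLinearEquiv.isUnit_det'.ne_zero

theorem isCompact_setOf_affine {X Y : Set (Space n)} (hX : (interior X).Nonempty)
    (hY : IsCompact Y) :
    IsCompact {p : (Space n →L[ℝ] Space n) × Space n | ∀ x ∈ X, p.1 x + p.2 ∈ Y} := by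
  have : ProperSpace (Space n →L[ℝ] Space n) := FiniteDimensional.proper_real _
  apply Metric.isCompact_of_isClosed_isBounded
  · have : {p : (Space n →L[ℝ] Space n) × Space n | ∀ x ∈ X, p.1 x + p.2 ∈ Y} =
        ⋂ x ∈ X, (fun p : (Space n →L[ℝ] Space n) × Space n => p.1 x + p.2) ⁻¹' Y := by
      ext p; simp
    rw [this]
    exact isClosed_biInter fun x _ => hY.isClosed.preimage (by fun_prop)
  · obtain ⟨x₀, hx₀⟩ := hX
    obtain ⟨r, hr, hball⟩ :=
      Metric.nhds_basis_closedBall.mem_iff.1 (mem_interior_iff_mem_nhds.1 hx₀)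
    obtain ⟨R, hR, hYR⟩ := hY.isBounded.subset_closedBall_lt 0 0
    rw [isBounded_iff_forall_norm_le]
    refine ⟨max (2 * R / r) (R + 2 * R / r * ‖x₀‖), ?_⟩
    rintro ⟨T, c⟩ h
    have hn : ∀ x ∈ X, ‖T x + c‖ ≤ R := fun x hx => by simpa using hYR (h x hx)
    have hT : ‖T‖ ≤ 2 * R / r := by
      refine T.opNorm_le_of_unit_norm (by positivity) fun u hu => ?_
      have h1 := hn (x₀ + r • u) (hball (by simp [norm_smul, hu, abs_of_pos hr]))
      have h2 := hn x₀ (interior_subset hx₀)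
      have h3 : r * ‖T u‖ ≤ R + R := calc
        r * ‖T u‖ = ‖(T (x₀ + r • u) + c) - (T x₀ + c)‖ := by
          rw [map_add, map_smul]
          simp [norm_smul, abs_of_pos hr]
        _ ≤ _ := (norm_sub_le _ _).trans (add_le_add h1 h2)
      rw [le_div_iff₀ hr]
      linarith
    have hc : ‖c‖ ≤ R + 2 * R / r * ‖x₀‖ := calc
      ‖c‖ = ‖(T x₀ + c) - T x₀‖ := by simp
      _ ≤ ‖T x₀ + c‖ + ‖T x₀‖ := norm_sub_le _ _
      _ ≤ R + 2 * R / r * ‖x₀‖ :=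
        add_le_add (hn x₀ (interior_subset hx₀)) (T.le_of_opNorm_le hT x₀)
    exact max_le_max hT hc

theorem exists_isMaxAffine {X Y : Set (Space n)} (hX : (interior X).Nonempty)
    (hY : IsCompact Y) (hY' : Y.Nonempty) : ∃ T c, IsMaxAffine X Y T c := by
  obtain ⟨y, hy⟩ := hY'
  obtain ⟨⟨T, c⟩, hTc, hmax⟩ := (isCompact_setOf_affine hX hY).exists_isMaxOn
    ⟨(0, y), fun x _ => by simpa using hy⟩
    (f := fun p => |p.1.det|)
    ((ContinuousLinearMap.continuous_det.comp continuous_fst).abs.continuousOn)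
  exact ⟨T, c, hTc, fun T' c' h => hmax (show (T', c') ∈ _ from h)⟩

theorem IsMaxAffine.det_ne_zero {X Y : Set (Space n)} {T : Space n →L[ℝ] Space n} {c : Space n}
    (h : IsMaxAffine X Y T c) (hX : Bornology.IsBounded X) (hY : (interior Y).Nonempty) :
    T.det ≠ 0 := by
  obtain ⟨y₀, hy₀⟩ := hY
  obtain ⟨r, hr, hball⟩ :=
    Metric.nhds_basis_closedBall.mem_iff.1 (mem_interior_iff_mem_nhds.1 hy₀)
  obtain ⟨R, hR, hXR⟩ := hX.subset_closedBall_lt 0 0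
  have h1 := h.abs_det_le ((r / R) • ContinuousLinearMap.id ℝ _) y₀ fun x hx => hball (by
    have : ‖x‖ ≤ R := by simpa using hXR hx
    simp only [mem_closedBall_iff_norm, add_sub_cancel_right]
    simp only [smul_apply, ContinuousLinearMap.id_apply, norm_smul,
      Real.norm_of_nonneg (div_pos hr hR).le]
    calc r / R * ‖x‖ ≤ r / R * R := by gcongr
      _ = r := by field_simp)
  rw [det_smul_eq] at h1
  have : (ContinuousLinearMap.id ℝ (Space n)).det = 1 := by simp [ContinuousLinearMap.det]
  rw [this, mul_one, abs_of_pos (by positivity)] at h1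
  exact abs_pos.1 (lt_of_lt_of_le (by positivity) h1)

theorem IsMaxAffine.image_right {X Y : Set (Space n)} {T : Space n →L[ℝ] Space n} {c : Space n}
    (h : IsMaxAffine X Y T c) (A : Space n ≃L[ℝ] Space n) (a : Space n) :
    IsMaxAffine X ((fun y => A y + a) '' Y) ((A : Space n →L[ℝ] Space n) ∘L T) (A c + a) := by
  refine ⟨fun x hx => ⟨T x + c, h.mapsTo x hx, by simp [add_assoc]⟩, fun T' c' h' => ?_⟩
  have h1 := h.abs_det_le ((A.symm : Space n →L[ℝ] Space n) ∘L T') (A.symm (c' - a)) fun x hx => by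
    obtain ⟨y, hy, hxy⟩ := h' x hx
    have : y = A.symm (T' x) + A.symm (c' - a) := by
      rw [← map_add, ← A.symm_apply_apply y]
      congr 1
      rw [← add_sub_assoc, ← hxy]
      simp
    rw [this] at hy
    exact hy
  have h2 : (A : Space n →L[ℝ] Space n) ∘L ((A.symm : Space n →L[ℝ] Space n) ∘L T') = T' := by
    ext1 x; simp
  rw [← h2, det_comp_eq (A : Space n →L[ℝ] Space n), det_comp_eq (A : Space n →L[ℝ] Space n),
    abs_mul, abs_mul]
  exact mul_le_mul_of_nonneg_left h1 (abs_nonneg _)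

theorem IsMaxAffine.preimage_left {X Y : Set (Space n)} {T : Space n →L[ℝ] Space n} {c : Space n}
    (h : IsMaxAffine X Y T c) (A : Space n ≃L[ℝ] Space n) (a : Space n) :
    IsMaxAffine ((fun x => A x + a) ⁻¹' X) Y (T ∘L (A : Space n →L[ℝ] Space n)) (T a + c) := by
  refine ⟨fun x hx => by simpa [add_assoc] using h.mapsTo _ hx, fun T' c' h' => ?_⟩
  have h1 := h.abs_det_le (T' ∘L (A.symm : Space n →L[ℝ] Space n)) (c' - T' (A.symm a))
    fun x hx => by
      have := h' (A.symm (x - a)) (by simpa using hx)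
      simp only [map_sub] at this
      simp only [ContinuousLinearMap.comp_apply, ContinuousLinearEquiv.coe_coe]
      convert this using 1
      abel
  have h2 : (T' ∘L (A.symm : Space n →L[ℝ] Space n)) ∘L (A : Space n →L[ℝ] Space n) = T' := by
    ext1 x; simp
  rw [← h2, det_comp_eq _ (A : Space n →L[ℝ] Space n), det_comp_eq _ (A : Space n →L[ℝ] Space n),
    abs_mul, abs_mul]
  exact mul_le_mul_of_nonneg_right h1 (abs_nonneg _)

/-- Strict log-concavity of the determinant, between the identity and a positive diagonal operator
of determinant one. -/
theorem eq_one_of_prod_half_add_half_mul_le {ι : Type*} [Fintype ι] {d : ι → ℝ} (hd : ∀ i, 0 < d i)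
    (h1 : ∏ i, d i = 1) (h2 : ∏ i, ((1 - 1 / 2) + 1 / 2 * d i) ≤ 1) (i : ι) : d i = 1 := by
  by_contra hi
  have hlt : ∏ i, d i < ∏ i, ((1 - 1 / 2) + 1 / 2 * d i) ^ 2 := by
    refine Finset.prod_lt_prod (fun i _ => hd i) (fun i _ => ?_) ⟨i, Finset.mem_univ _, ?_⟩
    · nlinarith [sq_nonneg (d i - 1)]
    · have : 0 < (d i - 1) ^ 2 := by have := sub_ne_zero.2 hi; positivity
      nlinarith
  rw [h1, Finset.prod_pow] at hlt
  have h0 : 0 ≤ ∏ i, ((1 - 1 / 2) + 1 / 2 * d i) :=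
    Finset.prod_nonneg fun i _ => by have := hd i; linarith
  nlinarith [pow_le_one₀ (n := 2) h0 h2]

theorem IsMaxAffine.abs_det_eq {X Y : Set (Space n)} {T₁ T₂ : Space n →L[ℝ] Space n}
    {c₁ c₂ : Space n} (h₁ : IsMaxAffine X Y T₁ c₁) (h₂ : IsMaxAffine X Y T₂ c₂) :
    |T₁.det| = |T₂.det| :=
  le_antisymm (h₂.abs_det_le _ _ h₁.mapsTo) (h₁.abs_det_le _ _ h₂.mapsTo)

/-- The John ellipsoid is unique, and so is its center. -/
theorem IsMaxAffine.image_closedBall_unique {Y : Set (Space n)} (hY : Convex ℝ Y)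
    {T₁ T₂ : Space n →L[ℝ] Space n} {c₁ c₂ : Space n}
    (h₁ : IsMaxAffine (closedBall 0 1) Y T₁ c₁) (h₂ : IsMaxAffine (closedBall 0 1) Y T₂ c₂)
    (hT₁ : T₁.det ≠ 0) :
    c₁ = c₂ ∧ T₁ '' closedBall 0 1 = T₂ '' closedBall 0 1 := by
  have hdet := h₁.abs_det_eq h₂
  have hT₂ : T₂.det ≠ 0 := abs_pos.1 (hdet ▸ abs_pos.2 hT₁)
  set E₁ := T₁.toContinuousLinearEquivOfDetNeZero hT₁
  set E₂ := T₂.toContinuousLinearEquivOfDetNeZero hT₂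
  set S : Space n →L[ℝ] Space n := (E₂.symm : Space n →L[ℝ] Space n) ∘L T₁ with hS
  have hTS : ∀ z, T₂ (S z) = T₁ z := fun z => E₂.apply_symm_apply (T₁ z)
  have hSdet : |S.det| = 1 := by
    have : T₂ ∘L S = T₁ := by ext1 z; exact hTS z
    have h := congrArg (fun A : Space n →L[ℝ] Space n => |A.det|) this
    simp only [det_comp_eq, abs_mul, hdet] at h
    exact (mul_eq_left₀ (abs_pos.2 hT₂).ne').1 h
  obtain ⟨b, d, hd, hSd, hprod⟩ := exists_norm_eq_norm_diagOp S
    (abs_pos.1 (hSdet ▸ one_pos))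
  rw [hSdet] at hprod
  have hmem : ∀ u ∈ closedBall (0 : Space n) 1,
      T₁ (diagOp b (fun i => (d i)⁻¹) u) + c₂ ∈ Y := fun u hu => by
    rw [← hTS]
    refine h₂.mapsTo _ ?_
    rw [mem_closedBall_zero_iff, hSd, diagOp_inv_diagOp b d hd]
    simpa using hu
  have hone : ∀ i, (d i)⁻¹ = 1 := by
    refine eq_one_of_prod_half_add_half_mul_le (fun i => inv_pos.2 (hd i)) (by simp [hprod]) ?_
    have h := h₁.abs_det_le (T₁ ∘L diagOp b fun i => (1 - 1 / 2) + 1 / 2 * (d i)⁻¹)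
      ((1 - 1 / 2 : ℝ) • c₁ + (1 / 2 : ℝ) • c₂) fun u hu => by
        have := hY (h₁.mapsTo u hu) (hmem u hu) (a := 1 - 1 / 2) (b := 1 / 2) (by norm_num)
          (by norm_num) (by norm_num)
        rw [ContinuousLinearMap.comp_apply, diagOp_one_sub_add, map_add, map_smul, map_smul]
        convert this using 1
        module
    rw [det_comp_eq, det_diagOp, abs_mul, mul_le_iff_le_one_right (abs_pos.2 hT₁)] at h
    exact (le_abs_self _).trans h
  have hSn : ∀ z, ‖S z‖ = ‖z‖ := fun z => by
    rw [hSd, show d = fun _ => 1 from funext fun i => inv_eq_one.1 (hone i), diagOp_one]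
  have himage : T₁ '' closedBall 0 1 = T₂ '' closedBall 0 1 := by
    apply Subset.antisymm
    · rintro _ ⟨u, hu, rfl⟩
      exact ⟨S u, by simpa [hSn] using hu, hTS u⟩
    · rintro _ ⟨u, hu, rfl⟩
      have hu' : T₁ (E₁.symm (T₂ u)) = T₂ u := E₁.apply_symm_apply _
      refine ⟨E₁.symm (T₂ u), ?_, hu'⟩
      rw [mem_closedBall_zero_iff, ← hSn,
        show S (E₁.symm (T₂ u)) = u from E₂.injective ((hTS _).trans hu')]
      simpa using hu
  refine ⟨?_, himage⟩
  -- Otherwise `Y` contains two translates of one ellipsoid, hence a stretched copy between them.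
  set v := E₁.symm ((1 / 2 : ℝ) • (c₂ - c₁)) with hv
  have hTv : T₁ v = (1 / 2 : ℝ) • (c₂ - c₁) := E₁.apply_symm_apply _
  have hc₂ : c₂ = c₁ + (2 : ℝ) • T₁ v := by rw [hTv]; module
  suffices h0 : v = 0 by rw [hc₂, h0]; simp
  by_contra hv0
  have hvpos : 0 < ‖v‖ := norm_pos_iff.2 hv0
  have h := h₁.abs_det_le (T₁ ∘L stretch ‖v‖⁻¹ v) (c₁ + T₁ v) fun u hu => by
    have hs : |‖v‖⁻¹ * inner ℝ v u| ≤ 1 := by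
      rw [abs_mul, abs_of_pos (inv_pos.2 hvpos)]
      have := abs_real_inner_le_norm v u
      have hu' : ‖u‖ ≤ 1 := by simpa using hu
      calc ‖v‖⁻¹ * |inner ℝ v u| ≤ ‖v‖⁻¹ * (‖v‖ * 1) := by gcongr; exact this.trans (by gcongr)
        _ = 1 := by field_simp
    obtain ⟨hs1, hs2⟩ := abs_le.1 hs
    have hm : T₁ u + c₂ ∈ Y := by
      obtain ⟨u', hu', he⟩ := himage.le (mem_image_of_mem T₁ hu)
      rw [← he]
      exact h₂.mapsTo _ hu'
    have := hY (h₁.mapsTo u hu) hm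
      (a := (1 - ‖v‖⁻¹ * inner ℝ v u) / 2) (b := (1 + ‖v‖⁻¹ * inner ℝ v u) / 2)
      (by linarith) (by linarith) (by ring)
    rw [hc₂] at this
    rw [ContinuousLinearMap.comp_apply, stretch_apply, map_add, map_smul]
    convert this using 1
    module
  rw [det_comp_eq, det_stretch, abs_mul, mul_le_iff_le_one_right (abs_pos.2 hT₁)] at h
  have h3 := (le_abs_self _).trans h
  have : 0 < ‖v‖⁻¹ * ‖v‖ ^ 2 := by positivity
  linarith

/-- The Löwner ellipsoid is unique, and so is its center: the ellipsoid is the sublevel set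
`‖S x + c‖ ≤ 1`, and its center the zero of `‖S x + c‖`. -/
theorem IsMaxAffine.norm_unique {X : Set (Space n)} {S₁ S₂ : Space n →L[ℝ] Space n}
    {c₁ c₂ : Space n} (h₁ : IsMaxAffine X (closedBall 0 1) S₁ c₁)
    (h₂ : IsMaxAffine X (closedBall 0 1) S₂ c₂) (hS₁ : S₁.det ≠ 0) (x : Space n) :
    ‖S₁ x + c₁‖ = ‖S₂ x + c₂‖ := by
  have hdet := h₁.abs_det_eq h₂
  have hS₂ : S₂.det ≠ 0 := abs_pos.1 (hdet ▸ abs_pos.2 hS₁)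
  set E₁ := S₁.toContinuousLinearEquivOfDetNeZero hS₁
  set E₂ := S₂.toContinuousLinearEquivOfDetNeZero hS₂
  set S : Space n →L[ℝ] Space n := S₂ ∘L (E₁.symm : Space n →L[ℝ] Space n) with hS
  have hSS : ∀ z, S (S₁ z) = S₂ z := fun z => congrArg S₂ (E₁.symm_apply_apply z)
  have hSdet : |S.det| = 1 := by
    have : S ∘L S₁ = S₂ := by ext1 z; exact hSS z
    have h := congrArg (fun A : Space n →L[ℝ] Space n => |A.det|) this
    simp only [det_comp_eq, abs_mul, hdet] at h
    exact (mul_eq_right₀ (abs_pos.2 hS₂).ne').1 h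
  obtain ⟨b, d, hd, hSd, hprod⟩ := exists_norm_eq_norm_diagOp S
    (abs_pos.1 (hSdet ▸ one_pos))
  rw [hSdet] at hprod
  set a := E₁ (E₂.symm c₂) - c₁ with ha
  have hSa : ∀ z, S (S₁ z + c₁ + a) = S₂ z + c₂ := fun z => by
    have : S₁ z + c₁ + a = S₁ (z + E₂.symm c₂) := by
      rw [ha, map_add]
      change _ = _ + E₁ _
      abel
    rw [this, hSS, map_add]
    congr 1
    exact E₂.apply_symm_apply c₂
  have hone : ∀ i, d i = 1 := by
    refine eq_one_of_prod_half_add_half_mul_le hd hprod ?_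
    have h := h₁.abs_det_le ((diagOp b fun i => (1 - 1 / 2) + 1 / 2 * d i) ∘L S₁)
      ((1 - 1 / 2 : ℝ) • c₁ + (1 / 2 : ℝ) • diagOp b d (c₁ + a)) fun u hu => by
        have h2 : diagOp b d (S₁ u + c₁ + a) ∈ closedBall (0 : Space n) 1 := by
          rw [mem_closedBall_zero_iff, ← hSd, hSa]
          simpa using h₂.mapsTo u hu
        have hC : Convex ℝ (closedBall (0 : Space n) 1) := convex_closedBall 0 1
        have := hC (h₁.mapsTo u hu) h2 (a := 1 - 1 / 2)
          (b := 1 / 2) (by norm_num) (by norm_num) (by norm_num)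
        rw [ContinuousLinearMap.comp_apply, diagOp_one_sub_add]
        convert this using 1
        simp only [map_add]
        module
    rw [det_comp_eq, det_diagOp, abs_mul, mul_le_iff_le_one_left (abs_pos.2 hS₁)] at h
    exact (le_abs_self _).trans h
  have hSn : ∀ z, ‖S z‖ = ‖z‖ := fun z => by
    rw [hSd, show d = fun _ => 1 from funext fun i => hone i, diagOp_one]
  suffices h0 : a = 0 by rw [← hSa, hSn, h0, add_zero]
  -- Otherwise the image of `X` lies in the intersection of two distinct unit balls, hence in a
  -- smaller ball.
  by_contra ha0
  have hn : n ≠ 0 := by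
    rintro rfl
    exact ha0 (Subsingleton.elim _ _)
  have hapos : 0 < ‖(1 / 2 : ℝ) • a‖ := norm_pos_iff.2 (smul_ne_zero (by norm_num) ha0)
  set m := (1 / 2 : ℝ) • a
  have hX : X.Nonempty := by
    by_contra hX
    rw [Set.not_nonempty_iff_eq_empty] at hX
    have h := h₁.abs_det_le ((2 : ℝ) • S₁) 0 (by simp [hX])
    rw [det_smul_eq, abs_mul, mul_le_iff_le_one_left (abs_pos.2 hS₁),
      abs_of_pos (by positivity)] at h
    exact absurd h (not_le.2 (one_lt_pow₀ (by norm_num) hn))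
  have hw : ∀ u ∈ X, ‖S₁ u + c₁ + m‖ ^ 2 + ‖m‖ ^ 2 ≤ 1 := fun u hu => by
    have e1 : ‖S₁ u + c₁‖ ≤ 1 := by simpa using h₁.mapsTo u hu
    have e2 : ‖S₁ u + c₁ + a‖ ≤ 1 := by
      rw [← hSn, hSa]
      simpa using h₂.mapsTo u hu
    have hp := parallelogram_law_with_norm ℝ (S₁ u + c₁ + m) m
    rw [show S₁ u + c₁ + m + m = S₁ u + c₁ + a by simp only [m]; module,
      add_sub_cancel_right] at hp
    nlinarith [norm_nonneg (S₁ u + c₁), norm_nonneg (S₁ u + c₁ + a)]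
  have hm1 : ‖m‖ ^ 2 ≤ 1 := by
    obtain ⟨u, hu⟩ := hX
    nlinarith [hw u hu, sq_nonneg ‖S₁ u + c₁ + m‖]
  set ρ := 1 - ‖m‖ ^ 2 / 2 with hρ
  have hρ0 : 0 < ρ := by rw [hρ]; linarith
  have hρ1 : ρ < 1 := by
    have : 0 < ‖m‖ ^ 2 := by positivity
    linarith
  have h := h₁.abs_det_le (ρ⁻¹ • S₁) (ρ⁻¹ • (c₁ + m)) fun u hu => by
    rw [mem_closedBall_zero_iff, smul_apply, ← smul_add, norm_smul,
      Real.norm_of_nonneg (inv_pos.2 hρ0).le, inv_mul_le_iff₀ hρ0, mul_one, ← add_assoc,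
      ← sq_le_sq₀ (norm_nonneg _) hρ0.le]
    have := hw u hu
    rw [hρ]
    nlinarith [sq_nonneg (‖m‖ ^ 2)]
  rw [det_smul_eq, abs_mul, mul_le_iff_le_one_left (abs_pos.2 hS₁), abs_of_pos (by positivity)] at h
  exact absurd h (not_le.2 (one_lt_pow₀ ((one_lt_inv₀ hρ0).2 hρ1) hn))

end MaxAffine

/-! ### Limits of affine maps of maximal determinant -/

section Limits

variable {n : ℕ}

/-- The homothety with center `x₀` and ratio `t` maps `X` into `X'`. -/
def ShrinksInto (x₀ : Space n) (t : ℝ) (X X' : Set (Space n)) : Prop :=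
  ∀ x ∈ X, x₀ + t • (x - x₀) ∈ X'

/-- Convergence of the sets `X' i` to `X` along `g`, seen from the point `x₀`: for each ratio
`t < 1`, the homothety with center `x₀` eventually maps each of `X` and `X' i` into the other. For
convex bodies and interior points `x₀` of the limit it follows from Hausdorff convergence. -/
def HomotheticLimit {ι : Type*} (g : Filter ι) (x₀ : Space n) (X' : ι → Set (Space n))
    (X : Set (Space n)) : Prop :=
  ∀ t ∈ Ioo (0 : ℝ) 1, ∀ᶠ i in g, ShrinksInto x₀ t X (X' i) ∧ ShrinksInto x₀ t (X' i) X

theorem HomotheticLimit.comp {ι κ : Type*} {g : Filter ι} {x₀ : Space n} {X' : ι → Set (Space n)}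
    {X : Set (Space n)} (h : HomotheticLimit g x₀ X' X) {f : Filter κ} {u : κ → ι}
    (hu : Tendsto u f g) : HomotheticLimit f x₀ (X' ∘ u) X :=
  fun t ht => hu.eventually (h t ht)

theorem homotheticLimit_closedBall {ι : Type*} (g : Filter ι) :
    HomotheticLimit g (0 : Space n) (fun _ => closedBall 0 1) (closedBall 0 1) := by
  intro t ht
  have : ShrinksInto (0 : Space n) t (closedBall 0 1) (closedBall 0 1) := fun x hx => by
    have hx' : ‖x‖ ≤ 1 := by simpa using hx
    have ht' := ht.1
    simpa [norm_smul, abs_of_pos ht'] using mul_le_one₀ ht.2.le (norm_nonneg x) hx'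
  exact Eventually.of_forall fun _ => ⟨this, this⟩

/-- The constant term of the affine map obtained from `x ↦ T x + c` by composing it with the
homotheties of ratio `t` about `x₀` before and about `y₀` after; its linear part is `t² T`. -/
noncomputable def conjConst (x₀ y₀ : Space n) (t : ℝ) (T : Space n →L[ℝ] Space n) (c : Space n) :
    Space n :=
  y₀ + t • (T (x₀ - t • x₀) + c - y₀)

theorem conj_apply (x₀ y₀ : Space n) (t : ℝ) (T : Space n →L[ℝ] Space n) (c x : Space n) :
    (t ^ 2 • T) x + conjConst x₀ y₀ t T c = y₀ + t • ((T (x₀ + t • (x - x₀)) + c) - y₀) := by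
  simp only [conjConst, smul_apply, map_add, map_sub, map_smul]
  module

/-- A limit of affine maps of maximal determinant between converging sets has maximal determinant:
conjugating a competitor by homotheties of ratio `t < 1` makes it a competitor for the approximating
sets, at the cost of a factor `t ^ (2 * n)` in the determinant. -/
theorem IsMaxAffine.of_tendsto {ι : Type*} {g : Filter ι} [g.NeBot] {X Y : Set (Space n)}
    {X' Y' : ι → Set (Space n)} {T' : ι → Space n →L[ℝ] Space n} {c' : ι → Space n}
    {T : Space n →L[ℝ] Space n} {c x₀ y₀ : Space n}
    (hX : HomotheticLimit g x₀ X' X) (hY : HomotheticLimit g y₀ Y' Y) (hYc : IsClosed Y)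
    (hT : Tendsto T' g (𝓝 T)) (hc : Tendsto c' g (𝓝 c))
    (hmax : ∀ i, IsMaxAffine (X' i) (Y' i) (T' i) (c' i)) : IsMaxAffine X Y T c := by
  have hmem : Ioo (0 : ℝ) 1 ∈ 𝓝[<] (1 : ℝ) := Ioo_mem_nhdsLT one_pos
  constructor
  · intro x hx
    have h1 : ∀ t ∈ Ioo (0 : ℝ) 1, y₀ + t • ((T (x₀ + t • (x - x₀)) + c) - y₀) ∈ Y := by
      intro t ht
      refine hYc.mem_of_tendsto (b := g)
        (f := fun i => y₀ + t • ((T' i (x₀ + t • (x - x₀)) + c' i) - y₀)) ?_ ?_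
      · have : Tendsto (fun i => T' i (x₀ + t • (x - x₀))) g (𝓝 (T (x₀ + t • (x - x₀)))) :=
          ((ContinuousLinearMap.apply ℝ _ (x₀ + t • (x - x₀))).continuous.tendsto T).comp hT
        exact tendsto_const_nhds.add (((this.add hc).sub tendsto_const_nhds).const_smul t)
      · filter_upwards [hX t ht, hY t ht] with i hi hi'
        exact hi'.2 _ ((hmax i).mapsTo _ (hi.1 x hx))
    have hlim : Tendsto (fun t : ℝ => y₀ + t • ((T (x₀ + t • (x - x₀)) + c) - y₀)) (𝓝[<] 1)
        (𝓝 (T x + c)) := by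
      have hcont : Continuous fun t : ℝ => y₀ + t • ((T (x₀ + t • (x - x₀)) + c) - y₀) := by
        fun_prop
      have := (hcont.tendsto 1).mono_left (nhdsWithin_le_nhds (s := Iio 1))
      simpa using this
    exact hYc.mem_of_tendsto hlim (mem_of_superset hmem h1)
  · intro S s hS
    have h1 : ∀ t ∈ Ioo (0 : ℝ) 1, (t ^ 2) ^ n * |S.det| ≤ |T.det| := by
      intro t ht
      refine ge_of_tendsto ((ContinuousLinearMap.continuous_det.tendsto T).comp hT).abs ?_
      filter_upwards [hX t ht, hY t ht] with i hi hi'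
      have := (hmax i).abs_det_le (t ^ 2 • S) (conjConst x₀ y₀ t S s) fun x hx => by
        rw [conj_apply]
        exact hi'.1 _ (hS _ (hi.2 x hx))
      rwa [det_smul_eq, abs_mul, abs_of_nonneg (by positivity)] at this
    have hlim : Tendsto (fun t : ℝ => (t ^ 2) ^ n * |S.det|) (𝓝[<] 1) (𝓝 |S.det|) := by
      have hcont : Continuous fun t : ℝ => (t ^ 2) ^ n * |S.det| := by fun_prop
      have := (hcont.tendsto 1).mono_left (nhdsWithin_le_nhds (s := Iio 1))
      simpa using this
    exact le_of_tendsto hlim (mem_of_superset hmem h1)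

/-- Compactness for affine maps between converging sets: conjugated by homotheties of ratio `1 / 2`,
they eventually belong to the compact set of affine maps between the limits. -/
theorem HomotheticLimit.exists_tendsto {ι : Type*} {g : Ultrafilter ι} {X Y : Set (Space n)}
    {X' Y' : ι → Set (Space n)} {T' : ι → Space n →L[ℝ] Space n} {c' : ι → Space n}
    {x₀ y₀ : Space n} (hX : HomotheticLimit (g : Filter ι) x₀ X' X)
    (hY : HomotheticLimit (g : Filter ι) y₀ Y' Y)
    (hXi : (interior X).Nonempty) (hYc : IsCompact Y)
    (hmap : ∀ i, ∀ x ∈ X' i, T' i x + c' i ∈ Y' i) :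
    ∃ T c, Tendsto T' g (𝓝 T) ∧ Tendsto c' g (𝓝 c) := by
  have ht : (1 / 2 : ℝ) ∈ Ioo (0 : ℝ) 1 := by norm_num
  set φ : ι → (Space n →L[ℝ] Space n) × Space n := fun i =>
    (((1 / 2 : ℝ) ^ 2) • T' i, conjConst x₀ y₀ (1 / 2) (T' i) (c' i)) with hφ
  have hev : ∀ᶠ i in (g : Filter ι), φ i ∈
      {p : (Space n →L[ℝ] Space n) × Space n | ∀ x ∈ X, p.1 x + p.2 ∈ Y} := by
    filter_upwards [hX _ ht, hY _ ht] with i hi hi' x hx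
    simp only [hφ]
    rw [conj_apply]
    exact hi'.2 _ (hmap i _ (hi.1 x hx))
  obtain ⟨⟨S, s⟩, -, hSs⟩ := (isCompact_setOf_affine hXi hYc).ultrafilter_le_nhds (g.map φ)
    (by simpa using (show _ ∈ (g : Filter ι) from hev))
  have hSs' : Tendsto φ g (𝓝 (S, s)) := hSs
  have h1 : Tendsto T' g (𝓝 ((4 : ℝ) • S)) := by
    have := ((continuous_fst.tendsto _).comp hSs').const_smul (4 : ℝ)
    convert this using 2 with i
    simp only [hφ, Function.comp_apply, smul_smul]
    norm_num
  refine ⟨_, (2 : ℝ) • (s - y₀) + y₀ - ((4 : ℝ) • S) (x₀ - (1 / 2 : ℝ) • x₀), h1, ?_⟩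
  have h2 : Tendsto (fun i => T' i (x₀ - (1 / 2 : ℝ) • x₀)) g
      (𝓝 (((4 : ℝ) • S) (x₀ - (1 / 2 : ℝ) • x₀))) :=
    ((ContinuousLinearMap.apply ℝ _ (x₀ - (1 / 2 : ℝ) • x₀)).continuous.tendsto _).comp h1
  have h3 := (((((continuous_snd.tendsto _).comp hSs').sub_const y₀).const_smul
    (2 : ℝ)).add_const y₀).sub h2
  convert h3 using 2 with i
  simp only [hφ, Function.comp_apply, conjConst]
  module

end Limits

/-! ### Hausdorff convergence of convex bodies -/

section Hausdorff

variable {n : ℕ}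

/-- A convex set close to `K` contains the points that lie deep inside `K`. -/
theorem mem_of_closedBall_subset {K L : Set (Space n)} (hL : Convex ℝ L) (hLc : IsClosed L)
    {x : Space n} {ε : ℝ} (hε : 0 < ε) (hx : closedBall x ε ⊆ K)
    (hKL : ∀ y ∈ K, ∃ z ∈ L, dist y z < ε) : x ∈ L := by
  by_contra hxL
  obtain ⟨f, u, hfL, hfx⟩ := geometric_hahn_banach_closed_point hL hLc hxL
  set v := (InnerProductSpace.toDual ℝ (Space n)).symm f
  have hv : ∀ y, inner ℝ v y = f y := fun y => InnerProductSpace.toDual_symm_apply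
  obtain ⟨z₀, hz₀, -⟩ := hKL x (hx (mem_closedBall_self hε.le))
  have hv0 : 0 < ‖v‖ := by
    rw [norm_pos_iff]
    intro h0
    have h1 := hfL z₀ hz₀
    rw [← hv, h0, inner_zero_left] at h1 hfx
    exact lt_asymm h1 hfx
  obtain ⟨z, hz, hdist⟩ := hKL (x + (ε / ‖v‖) • v) (hx (by
    simp [norm_smul, abs_of_pos hε, hv0.ne']))
  have h1 := real_inner_le_norm v (x + (ε / ‖v‖) • v - z)
  rw [dist_eq_norm] at hdist
  rw [inner_sub_right, inner_add_right, real_inner_smul_right, real_inner_self_eq_norm_sq, hv x,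
    hv z] at h1
  have h2 : ε / ‖v‖ * ‖v‖ ^ 2 = ‖v‖ * ε := by field_simp
  have := hfL z hz
  nlinarith

theorem Body.isCompact (K : Body n) : IsCompact K.toSet := K.1.isCompact

theorem Body.convex (K : Body n) : Convex ℝ K.toSet := K.1.convex

theorem Body.homotheticLimit (K : Body n) {x₀ : Space n} (hx₀ : x₀ ∈ interior K.toSet) :
    HomotheticLimit (𝓝 K) x₀ Body.toSet K.toSet := by
  intro t ht
  obtain ⟨r, hr, hball⟩ :=
    Metric.nhds_basis_closedBall.mem_iff.1 (mem_interior_iff_mem_nhds.1 hx₀)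
  have hε : 0 < (1 - t) * r := mul_pos (by linarith [ht.2]) hr
  -- By convexity the shrunk copy of `K` has distance `(1 - t) r` from the complement of `K`.
  have hdeep : ∀ y ∈ K.toSet, closedBall (x₀ + t • (y - x₀)) ((1 - t) * r) ⊆ K.toSet := by
    intro y hy z hz
    have h1t : 1 - t ≠ 0 := by linarith [ht.2]
    set w := x₀ + (1 - t)⁻¹ • (z - (x₀ + t • (y - x₀))) with hw
    have hwK : w ∈ K.toSet := by
      apply hball
      rw [mem_closedBall_iff_norm] at hz ⊢
      rw [hw, add_sub_cancel_left, norm_smul,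
        Real.norm_of_nonneg (by rw [inv_nonneg]; linarith [ht.2]),
        inv_mul_le_iff₀ (by linarith [ht.2])]
      exact hz
    have := K.convex hy hwK ht.1.le (by linarith [ht.2] : 0 ≤ 1 - t) (by ring)
    convert this using 1
    rw [hw, smul_add, smul_smul, mul_inv_cancel₀ h1t]
    module
  have hnhds : ∀ᶠ L in 𝓝 K, dist L K < (1 - t) * r := Metric.ball_mem_nhds K hε
  filter_upwards [hnhds] with L hL
  have hL' : hausdorffDist L.toSet K.toSet < (1 - t) * r := hL
  have hfin : hausdorffEDist L.toSet K.toSet ≠ ⊤ := ConvexBody.hausdorffEDist_ne_top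
  constructor
  · intro y hy
    refine mem_of_closedBall_subset L.convex L.isCompact.isClosed hε (hdeep y hy) fun y hy => ?_
    obtain ⟨z, hz, h⟩ := exists_dist_lt_of_hausdorffDist_lt' hy hL' hfin
    exact ⟨z, hz, by rwa [dist_comm]⟩
  · intro y hy
    obtain ⟨z, hz, h⟩ := exists_dist_lt_of_hausdorffDist_lt hy hL' hfin
    refine hdeep z hz ?_
    rw [mem_closedBall_iff_norm]
    rw [dist_eq_norm] at h
    calc ‖x₀ + t • (y - x₀) - (x₀ + t • (z - x₀))‖ = t * ‖y - z‖ := by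
          rw [← Real.norm_of_nonneg ht.1.le, ← norm_smul, Real.norm_of_nonneg ht.1.le]
          congr 1
          module
      _ ≤ 1 * ‖y - z‖ := by gcongr; exact ht.2.le
      _ ≤ (1 - t) * r := by linarith

end Hausdorff

/-! ### Polars of balls and of John ellipsoids -/

section Polarity

variable {n : ℕ}

theorem polarSet_polarSet {K : Set (Space n)} (hK : Convex ℝ K) (hKc : IsClosed K) {x : Space n}
    (hx : x ∈ K) : polarSet (polarSet K x) x = K := by
  apply Subset.antisymm
  · intro y hy
    by_contra hyK
    obtain ⟨f, u, hfK, hfy⟩ := geometric_hahn_banach_closed_point hK hKc hyK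
    set v := (InnerProductSpace.toDual ℝ (Space n)).symm f
    have hv : ∀ z, inner ℝ v z = f z := fun z => InnerProductSpace.toDual_symm_apply
    have hm : 0 < u - f x := sub_pos.2 (hfK x hx)
    have hz : x + (u - f x)⁻¹ • v ∈ polarSet K x := fun k hk => by
      rw [add_sub_cancel_left, real_inner_smul_left, hv, map_sub, inv_mul_le_iff₀ hm]
      linarith [hfK k hk]
    have h := hy _ hz
    rw [add_sub_cancel_left, real_inner_smul_right, real_inner_comm, hv, map_sub,
      inv_mul_le_iff₀ hm] at h
    linarith
  · intro y hy z hz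
    rw [real_inner_comm]
    exact hz y hy

theorem norm_le_of_forall_inner_le {p : Space n} {k : ℝ}
    (h : ∀ u ∈ closedBall (0 : Space n) 1, inner ℝ u p ≤ k) : ‖p‖ ≤ k := by
  rcases eq_or_ne p 0 with rfl | hp
  · simpa using h 0 (by simp)
  · have hp' : 0 < ‖p‖ := norm_pos_iff.2 hp
    have := h (‖p‖⁻¹ • p) (by simp [norm_smul, hp])
    rw [real_inner_smul_left, real_inner_self_eq_norm_sq] at this
    convert this using 1
    field_simp

/-- The polar, with respect to the origin, of the unit ball with center `c` contains a unit ball. -/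
theorem inner_add_norm_le_one {c u : Space n} (hc : ‖c‖ < 1) (hu : ‖u‖ ≤ 1) :
    inner ℝ c (u - (1 - ‖c‖ ^ 2)⁻¹ • c) + ‖u - (1 - ‖c‖ ^ 2)⁻¹ • c‖ ≤ 1 := by
  have hs : 0 < 1 - ‖c‖ ^ 2 := by nlinarith [norm_nonneg c]
  set k := (1 - ‖c‖ ^ 2)⁻¹ with hk
  have hk1 : k * (1 - ‖c‖ ^ 2) = 1 := inv_mul_cancel₀ hs.ne'
  have hk0 : 1 ≤ k := (one_le_inv₀ hs).2 (by nlinarith [norm_nonneg c])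
  have hw := real_inner_le_norm c u
  have hw1 : inner ℝ c u ≤ 1 := hw.trans (mul_le_one₀ hc.le (norm_nonneg _) hu)
  have e1 : inner ℝ c (u - k • c) = inner ℝ c u - k * ‖c‖ ^ 2 := by
    rw [inner_sub_right, real_inner_smul_right, real_inner_self_eq_norm_sq]
  have e2 : ‖u - k • c‖ ^ 2 = ‖u‖ ^ 2 - 2 * k * inner ℝ c u + k ^ 2 * ‖c‖ ^ 2 := by
    rw [norm_sub_sq_real, real_inner_smul_right, norm_smul, mul_pow, Real.norm_eq_abs, sq_abs,
      real_inner_comm]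
    ring
  have h3 : ‖u - k • c‖ ≤ k - inner ℝ c u := by
    rw [← sq_le_sq₀ (norm_nonneg _) (by linarith), e2]
    have : k ^ 2 * ‖c‖ ^ 2 = k ^ 2 - k := by linear_combination (-k) * hk1
    have hu2 : ‖u‖ ^ 2 ≤ 1 := pow_le_one₀ (norm_nonneg _) hu
    nlinarith [sq_nonneg (inner ℝ c u)]
  rw [e1]
  linarith

/-- The polar, with respect to the origin, of the unit ball with center `c` is contained in a ball
whose radius exceeds `1` only to second order in `c`. -/
theorem norm_add_le_of_inner_add_norm_le_one {c z : Space n} (hc : ‖c‖ < 1)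
    (hz : inner ℝ c z + ‖z‖ ≤ 1) :
    ‖(1 - ‖c‖ ^ 2) • z + c‖ ≤ 1 := by
  have hs : 0 < 1 - ‖c‖ ^ 2 := by nlinarith [norm_nonneg c]
  have hcs := abs_le.1 (abs_real_inner_le_norm c z)
  have hw2 : inner ℝ c z ^ 2 ≤ ‖c‖ ^ 2 * ‖z‖ ^ 2 := by
    rw [← mul_pow, ← sq_abs]
    gcongr
    exact abs_real_inner_le_norm c z
  have hz2 : ‖z‖ ^ 2 ≤ (1 - inner ℝ c z) ^ 2 := by
    gcongr
    linarith
  have h1 : (1 - ‖c‖ ^ 2) * ‖z‖ ^ 2 + 2 * inner ℝ c z ≤ 1 := by nlinarith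
  rw [← sq_le_sq₀ (norm_nonneg _) zero_le_one, norm_add_sq_real, real_inner_smul_left, norm_smul,
    Real.norm_of_nonneg hs.le, mul_pow, real_inner_comm]
  nlinarith [mul_le_mul_of_nonneg_left h1 hs.le]

/-- Polarity with respect to the center turns the John ellipsoid into the Löwner ellipsoid. -/
theorem IsMaxAffine.polar_of_john {K : Set (Space n)} (hK : Convex ℝ K) (hKc : IsCompact K)
    {T : Space n →L[ℝ] Space n} {x : Space n} (hx : x ∈ K)
    (h : IsMaxAffine (closedBall 0 1) K T x) :
    IsMaxAffine (polarSet K x) (closedBall 0 1) (ContinuousLinearMap.adjoint T)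
      (-ContinuousLinearMap.adjoint T x) := by
  constructor
  · intro y hy
    rw [mem_closedBall_zero_iff, ← sub_eq_add_neg, ← map_sub]
    refine norm_le_of_forall_inner_le fun u hu => ?_
    rw [ContinuousLinearMap.adjoint_inner_right, real_inner_comm]
    simpa using hy _ (h.mapsTo u hu)
  · intro S c hS
    rw [det_adjoint]
    rcases eq_or_ne S.det 0 with h0 | h0
    · simp [h0]
    set E := S.toContinuousLinearEquivOfDetNeZero h0
    set c₀ := -(S x + c) with hc₀
    -- `x` is an interior point of the polar, hence of the ellipsoid `‖S y + c‖ ≤ 1`.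
    have hc₀lt : ‖c₀‖ < 1 := by
      have hSE : S (E.symm c₀) = c₀ := E.apply_symm_apply c₀
      have hev : ∀ᶠ δ in 𝓝[>] (0 : ℝ), x - δ • E.symm c₀ ∈ polarSet K x := by
        have hcont : Continuous fun δ : ℝ => x - δ • E.symm c₀ := by fun_prop
        have := (hcont.tendsto 0).mono_left (nhdsWithin_le_nhds (s := Ioi 0))
        rw [zero_smul, sub_zero] at this
        exact this (mem_interior_iff_mem_nhds.1 (mem_interior_polarSet hKc.isBounded x))
      obtain ⟨δ, hδ, hδ0 : 0 < δ⟩ := (hev.and self_mem_nhdsWithin).exists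
      have h1 := hS _ hδ
      rw [mem_closedBall_zero_iff, map_sub, map_smul, hSE,
        show S x - δ • c₀ + c = -((1 + δ) • c₀) by rw [hc₀]; module, norm_neg, norm_smul,
        Real.norm_of_nonneg (by linarith)] at h1
      nlinarith [norm_nonneg c₀]
    -- The polar of that ellipsoid contains an ellipsoid with linear part `S*`, which lies in `K` by
    -- the bipolar theorem.
    have h1 := h.abs_det_le (ContinuousLinearMap.adjoint S)
      (x - ContinuousLinearMap.adjoint S ((1 - ‖c₀‖ ^ 2)⁻¹ • c₀)) fun u hu => by
        rw [← polarSet_polarSet hK hKc.isClosed hx]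
        intro z hz
        rw [show ContinuousLinearMap.adjoint S u +
            (x - ContinuousLinearMap.adjoint S ((1 - ‖c₀‖ ^ 2)⁻¹ • c₀)) - x =
            ContinuousLinearMap.adjoint S (u - (1 - ‖c₀‖ ^ 2)⁻¹ • c₀) by rw [map_sub]; abel,
          ContinuousLinearMap.adjoint_inner_left,
          show S (z - x) = c₀ + (S z + c) by rw [map_sub, hc₀]; abel, inner_add_right]
        have hz1 : ‖S z + c‖ ≤ 1 := by simpa using hS z hz
        have hu1 : ‖u‖ ≤ 1 := by simpa using hu
        have h2 := inner_add_norm_le_one hc₀lt hu1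
        have h3 := real_inner_le_norm (u - (1 - ‖c₀‖ ^ 2)⁻¹ • c₀) (S z + c)
        rw [real_inner_comm]
        nlinarith [norm_nonneg (u - (1 - ‖c₀‖ ^ 2)⁻¹ • c₀)]
    rwa [det_adjoint] at h1

end Polarity

/-! ### First-order optimality of the Löwner ellipsoid -/

section Variation

variable {n : ℕ}

theorem inner_diagOp_comm (b : OrthonormalBasis (Fin n) ℝ (Space n)) (d : Fin n → ℝ)
    (x y : Space n) : inner ℝ (diagOp b d x) y = inner ℝ x (diagOp b d y) := by
  rw [← b.repr.inner_map_map, ← b.repr.inner_map_map x, PiLp.inner_apply, PiLp.inner_apply]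
  refine Finset.sum_congr rfl fun i _ => ?_
  rw [repr_diagOp, repr_diagOp]
  simp
  ring

theorem norm_diagOp_le (b : OrthonormalBasis (Fin n) ℝ (Space n)) {d : Fin n → ℝ} {M : ℝ}
    (hM : 0 ≤ M) (hd : ∀ i, |d i| ≤ M) (x : Space n) : ‖diagOp b d x‖ ≤ M * ‖x‖ := by
  rw [← sq_le_sq₀ (norm_nonneg _) (by positivity), norm_sq_diagOp, mul_pow, ← b.repr.norm_map,
    EuclideanSpace.real_norm_sq_eq, Finset.mul_sum]
  refine Finset.sum_le_sum fun i _ => ?_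
  rw [mul_pow, ← sq_abs (d i)]
  gcongr
  exact hd i

theorem one_add_mul_log_prod_le {ι : Type*} [Fintype ι] {d : ι → ℝ} (hd : ∀ i, 0 < d i) {t : ℝ}
    (ht0 : 0 ≤ t) (ht1 : t ≤ 1) : 1 + t * Real.log (∏ i, d i) ≤ ∏ i, ((1 - t) + t * d i) := by
  have hP : 0 < ∏ i, d i := Finset.prod_pos fun i _ => hd i
  calc 1 + t * Real.log (∏ i, d i) ≤ (∏ i, d i) ^ t := by
        rw [Real.rpow_def_of_pos hP, add_comm, mul_comm]
        exact Real.add_one_le_exp _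
    _ = ∏ i, d i ^ t := (Real.finsetProd_rpow _ _ (fun i _ => (hd i).le) t).symm
    _ ≤ _ := by
        refine Finset.prod_le_prod (fun i _ => by have := hd i; positivity) fun i _ => ?_
        have := Real.geom_mean_le_arith_mean2_weighted (sub_nonneg.2 ht1) ht0 zero_le_one
          (hd i).le (by ring)
        simpa using this

/-- The first-order optimality condition for the Löwner ellipsoid: if it is the unit ball, the polar
of `X` contains no ellipsoid of larger volume. The ellipsoids `c + A* B` between the unit ball and
such an ellipsoid have volumes increasing at a positive rate, while the loss caused by moving the
center is of second order, so their polars would be ellipsoids around `X` smaller than the ball. -/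
theorem IsMaxAffine.abs_det_le_one {X : Set (Space n)}
    (h : IsMaxAffine X (closedBall 0 1) (ContinuousLinearMap.id ℝ _) 0) {A : Space n →L[ℝ] Space n}
    {c : Space n} (hA : ∀ z ∈ X, inner ℝ c z + ‖A z‖ ≤ 1) : |A.det| ≤ 1 := by
  rcases eq_or_ne A.det 0 with h0 | h0
  · simp [h0]
  obtain ⟨b, d, hd, hAd, hprod⟩ := exists_norm_eq_norm_diagOp A h0
  by_contra! hlt
  set α := Real.log (∏ i, d i) with hα
  have hα0 : 0 < α := by rw [hα, hprod]; exact Real.log_pos hlt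
  -- `t` is so small that the first-order gain `t α` outweighs the second-order loss
  -- `n (2 t ‖c‖)²`; `t < 1 / 2` bounds the inverse of the interpolated operator by `2`.
  have hev : ∀ᶠ t in 𝓝[>] (0 : ℝ), t < 1 / 2 ∧ 2 * t * ‖c‖ < 1 ∧
      n * (4 * t * ‖c‖ ^ 2) * (1 + α) < α := by
    refine nhdsWithin_le_nhds (Filter.Eventually.and ?_ (Filter.Eventually.and ?_ ?_))
    · exact gt_mem_nhds (by norm_num)
    · have : Continuous fun t : ℝ => 2 * t * ‖c‖ := by fun_prop
      exact this.tendsto 0 |>.eventually (gt_mem_nhds (by simp))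
    · have : Continuous fun t : ℝ => n * (4 * t * ‖c‖ ^ 2) * (1 + α) := by fun_prop
      exact this.tendsto 0 |>.eventually (gt_mem_nhds (by simpa using hα0))
  obtain ⟨t, ⟨ht1, ht2, ht3⟩, ht0 : 0 < t⟩ := (hev.and self_mem_nhdsWithin).exists
  set dt : Fin n → ℝ := fun i => (1 - t) + t * d i with hdt
  have hdt_half : ∀ i, 1 / 2 < dt i := fun i => by
    have := mul_pos ht0 (hd i)
    simp only [hdt]
    linarith
  have hdt_pos : ∀ i, 0 < dt i := fun i => by linarith [hdt_half i]
  set c₀ := diagOp b (fun i => (dt i)⁻¹) (t • c) with hc₀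
  have hc₀n : ‖c₀‖ ≤ 2 * t * ‖c‖ := by
    have := norm_diagOp_le b (d := fun i => (dt i)⁻¹) (M := 2) (by norm_num) (fun i => by
      rw [abs_of_pos (inv_pos.2 (hdt_pos i))]
      exact (inv_le_comm₀ (hdt_pos i) two_pos).2 (by linarith [hdt_half i])) (t • c)
    rwa [norm_smul, Real.norm_of_nonneg ht0.le, ← mul_assoc] at this
  have hc₀lt : ‖c₀‖ < 1 := hc₀n.trans_lt ht2
  have h1 := h.abs_det_le ((1 - ‖c₀‖ ^ 2) • diagOp b dt) c₀ fun z hz => by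
    rw [mem_closedBall_zero_iff, smul_apply]
    refine norm_add_le_of_inner_add_norm_le_one hc₀lt ?_
    have hz1 : ‖z‖ ≤ 1 := by simpa using h.mapsTo z hz
    have e1 : inner ℝ c₀ (diagOp b dt z) = t * inner ℝ c z := by
      rw [← inner_diagOp_comm, hc₀, diagOp_inv_diagOp b dt hdt_pos, real_inner_smul_left]
    have e2 : ‖diagOp b dt z‖ ≤ (1 - t) * ‖z‖ + t * ‖A z‖ := by
      rw [hdt, diagOp_one_sub_add, hAd]
      refine (norm_add_le _ _).trans_eq ?_
      rw [norm_smul, norm_smul, Real.norm_of_nonneg ht0.le, Real.norm_of_nonneg (by linarith)]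
    rw [e1]
    nlinarith [hA z hz]
  have hid : (ContinuousLinearMap.id ℝ (Space n)).det = 1 := by simp [ContinuousLinearMap.det]
  rw [det_smul_eq, det_diagOp, hid, abs_one] at h1
  have hlog := one_add_mul_log_prod_le hd ht0.le (by linarith)
  rw [← hα] at hlog
  have hc₀sq : ‖c₀‖ ^ 2 ≤ 4 * t ^ 2 * ‖c‖ ^ 2 := by
    calc ‖c₀‖ ^ 2 ≤ (2 * t * ‖c‖) ^ 2 := by gcongr
      _ = _ := by ring
  -- Bernoulli's inequality.
  have hbern := one_add_mul_le_pow (a := -‖c₀‖ ^ 2) (by nlinarith [norm_nonneg c₀]) n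
  have hn : (n : ℝ) * ‖c₀‖ ^ 2 ≤ n * (4 * t ^ 2 * ‖c‖ ^ 2) := by gcongr
  have hpow0 : 0 ≤ (1 - ‖c₀‖ ^ 2) ^ n := pow_nonneg (by nlinarith [norm_nonneg c₀]) n
  have hfinal : (1 - n * (4 * t ^ 2 * ‖c‖ ^ 2)) * (1 + t * α) ≤ 1 := by
    have htα : 0 < 1 + t * α := by positivity
    calc _ ≤ (1 - ‖c₀‖ ^ 2) ^ n * (1 + t * α) := by
          gcongr
          rw [sub_eq_add_neg 1 (‖c₀‖ ^ 2)]
          linarith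
      _ ≤ (1 - ‖c₀‖ ^ 2) ^ n * ∏ i, dt i := by gcongr
      _ ≤ 1 := (le_abs_self _).trans h1
  have hN : 0 ≤ n * (4 * t * ‖c‖ ^ 2) := by positivity
  have h4 : t * α ≤ t * (n * (4 * t * ‖c‖ ^ 2) * (1 + t * α)) := by nlinarith
  have h5 := le_of_mul_le_mul_left h4 ht0
  have h6 : n * (4 * t * ‖c‖ ^ 2) * (1 + t * α) ≤ n * (4 * t * ‖c‖ ^ 2) * (1 + α) := by
    gcongr
    nlinarith
  linarith

/-- An affine change of coordinates turns the Löwner ellipsoid into the unit ball. -/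
theorem IsMaxAffine.normalize {X : Set (Space n)} {S : Space n →L[ℝ] Space n} {c x : Space n}
    (h : IsMaxAffine X (closedBall 0 1) S c) (hS : S.det ≠ 0) (hx : S x + c = 0) :
    IsMaxAffine ((fun z => (S.toContinuousLinearEquivOfDetNeZero hS).symm z + x) ⁻¹' X)
      (closedBall 0 1) (ContinuousLinearMap.id ℝ _) 0 := by
  have h1 := h.preimage_left (S.toContinuousLinearEquivOfDetNeZero hS).symm x
  rw [hx] at h1
  convert h1
  ext1 z
  exact ((S.toContinuousLinearEquivOfDetNeZero hS).apply_symm_apply z).symm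

/-- The center of the Löwner ellipsoid is an interior point: a unit ball around a subset of one of
its half-balls, bounded by a hyperplane through the center, does not have minimal volume. -/
theorem IsMaxAffine.mem_interior {X : Set (Space n)} (hX : Convex ℝ X)
    (hXi : (interior X).Nonempty) {S : Space n →L[ℝ] Space n} {c x : Space n}
    (h : IsMaxAffine X (closedBall 0 1) S c) (hS : S.det ≠ 0) (hx : S x + c = 0) :
    x ∈ interior X := by
  by_contra hxX
  obtain ⟨f, hf⟩ := geometric_hahn_banach_open_point hX.interior isOpen_interior hxX
  have hf' : ∀ a ∈ X, f a ≤ f x := fun a ha => by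
    have hcl : closure (interior X) ⊆ {a | f a ≤ f x} :=
      closure_minimal (fun a ha => (hf a ha).le) (isClosed_le f.continuous continuous_const)
    rw [hX.closure_interior_eq_closure_of_nonempty_interior hXi] at hcl
    exact hcl (subset_closure ha)
  set E := S.toContinuousLinearEquivOfDetNeZero hS
  set v := (InnerProductSpace.toDual ℝ (Space n)).symm (f ∘L (E.symm : Space n →L[ℝ] Space n))
  have hv : ∀ z, inner ℝ v z = f (E.symm z) := fun z => InnerProductSpace.toDual_symm_apply
  have hv0 : 0 < ‖v‖ := by
    rw [norm_pos_iff]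
    intro h0
    obtain ⟨a, ha⟩ := hXi
    have h1 := hf a ha
    have h2 : ∀ y, f y = 0 := fun y => by
      rw [← E.symm_apply_apply y, ← hv, h0, inner_zero_left]
    rw [h2, h2] at h1
    exact lt_irrefl _ h1
  have hN := h.normalize hS hx
  -- The polar of the half-ball contains the ball stretched by `2` along the normal direction `e`
  -- and moved by `e`.
  have h2 := hN.abs_det_le_one (A := stretch 1 (‖v‖⁻¹ • v)) (c := ‖v‖⁻¹ • v) fun z hz => by
    have he : ‖‖v‖⁻¹ • v‖ = 1 := by simp [norm_smul, hv0.ne']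
    set e := ‖v‖⁻¹ • v with he'
    have hz1 : ‖z‖ ≤ 1 := by simpa using hN.mapsTo z hz
    have hw0 : inner ℝ e z ≤ 0 := by
      rw [he', real_inner_smul_left, hv]
      have := hf' _ hz
      rw [map_add] at this
      have : f (E.symm z) ≤ 0 := by linarith
      exact mul_nonpos_of_nonneg_of_nonpos (by positivity) this
    have hw1 : -1 ≤ inner ℝ e z := by
      have := (abs_le.1 (abs_real_inner_le_norm e z)).1
      rw [he, one_mul] at this
      linarith
    have hs : ‖stretch 1 e z‖ ^ 2 = ‖z‖ ^ 2 + 3 * inner ℝ e z ^ 2 := by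
      rw [stretch_apply, norm_add_sq_real, real_inner_smul_right, norm_smul, he, mul_one,
        Real.norm_eq_abs, sq_abs, real_inner_comm]
      ring
    have : ‖stretch 1 e z‖ ≤ 1 - inner ℝ e z := by
      rw [← sq_le_sq₀ (norm_nonneg _) (by linarith), hs]
      nlinarith [norm_nonneg z]
    linarith
  rw [det_stretch, norm_smul, norm_inv, norm_norm, inv_mul_cancel₀ hv0.ne'] at h2
  norm_num at h2

/-- Polarity with respect to the center turns the Löwner ellipsoid into the John ellipsoid. -/
theorem IsMaxAffine.polar_of_loewner {X : Set (Space n)} {S : Space n →L[ℝ] Space n}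
    {c x : Space n} (h : IsMaxAffine X (closedBall 0 1) S c) (hS : S.det ≠ 0) (hx : S x + c = 0) :
    IsMaxAffine (closedBall 0 1) (polarSet X x) (ContinuousLinearMap.adjoint S) x := by
  constructor
  · intro u hu a ha
    rw [add_sub_cancel_right, ContinuousLinearMap.adjoint_inner_left,
      show S (a - x) = S a + c by rw [map_sub, eq_neg_of_add_eq_zero_left hx, sub_neg_eq_add]]
    have h1 : ‖S a + c‖ ≤ 1 := by simpa using h.mapsTo a ha
    have h2 : ‖u‖ ≤ 1 := by simpa using hu
    exact (real_inner_le_norm _ _).trans (mul_le_one₀ h2 (norm_nonneg _) h1)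
  · intro T c' hT
    set E := S.toContinuousLinearEquivOfDetNeZero hS
    have h1 := (h.normalize hS hx).abs_det_le_one
      (A := ContinuousLinearMap.adjoint T ∘L (E.symm : Space n →L[ℝ] Space n))
      (c := ContinuousLinearMap.adjoint (E.symm : Space n →L[ℝ] Space n) (c' - x)) fun z hz => by
        rw [ContinuousLinearMap.adjoint_inner_left, add_comm, ← le_sub_iff_add_le]
        refine norm_le_of_forall_inner_le fun u hu => ?_
        have hz' : E.symm z + x ∈ X := hz
        have h2 : inner ℝ (T u + c' - x) (E.symm z + x - x) ≤ 1 := hT u hu _ hz'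
        rw [add_sub_cancel_right, add_sub_assoc, inner_add_left] at h2
        change inner ℝ u (T.adjoint (E.symm z)) ≤ 1 - inner ℝ (c' - x) (E.symm z)
        rw [ContinuousLinearMap.adjoint_inner_right]
        linarith
    have h2 : (T.adjoint ∘L (E.symm : Space n →L[ℝ] Space n)) ∘L S = T.adjoint := by
      ext1 z
      exact congrArg T.adjoint (E.symm_apply_apply z)
    rw [det_adjoint, ← det_adjoint T, ← h2, det_comp_eq _ S, abs_mul]
    exact mul_le_of_le_one_left (abs_nonneg _) h1

end Variation

/-! ### Ellipsoids and affine maps -/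

section Ellipsoids

variable {n : ℕ}

theorem isEllipsoidWithCenter_iff {E : Set (Space n)} {c : Space n} :
    IsEllipsoidWithCenter E c ↔
      ∃ T : Space n →L[ℝ] Space n, T.det ≠ 0 ∧ E = (fun y => T y + c) '' closedBall 0 1 := by
  constructor
  · rintro ⟨T, rfl⟩
    exact ⟨T.toContinuousLinearEquiv, det_equiv_ne_zero _,
      by simp only [add_comm c]; rfl⟩
  · rintro ⟨T, hT, rfl⟩
    exact ⟨(T.toContinuousLinearEquivOfDetNeZero hT).toLinearEquiv,
      by simp only [add_comm c]; rfl⟩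

theorem preimage_affine_eq_image {S : Space n →L[ℝ] Space n} (hS : S.det ≠ 0) {c x : Space n}
    (hx : S x + c = 0) (B : Set (Space n)) :
    (fun y => S y + c) ⁻¹' B =
      (fun u => ((S.toContinuousLinearEquivOfDetNeZero hS).symm : Space n →L[ℝ] Space n) u + x) ''
        B := by
  set E := S.toContinuousLinearEquivOfDetNeZero hS
  have hE : ∀ y, S y = E y := fun _ => rfl
  ext y
  constructor
  · intro hy
    refine ⟨S y + c, hy, ?_⟩
    have : S y + c = E (y - x) := by
      rw [← hE, map_sub, eq_neg_of_add_eq_zero_left hx, sub_neg_eq_add]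
    simp [this]
  · rintro ⟨u, hu, rfl⟩
    have : S (E.symm u + x) + c = u := by
      rw [map_add, add_assoc, hx, add_zero]
      exact E.apply_symm_apply u
    change S (E.symm u + x) + c ∈ B
    rwa [this]

theorem isEllipsoidWithCenter_iff_preimage {E : Set (Space n)} {x : Space n} :
    IsEllipsoidWithCenter E x ↔ ∃ (S : Space n →L[ℝ] Space n) (c : Space n), S.det ≠ 0 ∧
      S x + c = 0 ∧ E = (fun y => S y + c) ⁻¹' closedBall 0 1 := by
  rw [isEllipsoidWithCenter_iff]
  constructor
  · rintro ⟨T, hT, rfl⟩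
    set A := T.toContinuousLinearEquivOfDetNeZero hT
    refine ⟨A.symm, -A.symm x, det_equiv_ne_zero _, by simp, ?_⟩
    rw [preimage_affine_eq_image (det_equiv_ne_zero A.symm) (x := x) (by simp)]
    refine image_congr fun u _ => ?_
    congr 1
    refine (ContinuousLinearEquiv.eq_symm_apply _).2 ?_
    exact A.symm_apply_apply u
  · rintro ⟨S, c, hS, hx, rfl⟩
    exact ⟨_, det_equiv_ne_zero _, preimage_affine_eq_image hS hx _⟩

theorem volume_image_affine (T : Space n →L[ℝ] Space n) (c : Space n) (B : Set (Space n)) :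
    volume ((fun y => T y + c) '' B) = ENNReal.ofReal |T.det| * volume B := by
  rw [← Measure.addHaar_image_continuousLinearMap volume T B, ← image_image (· + c) T B,
    image_add_right, measure_preimage_add_right]

theorem volume_preimage_affine {S : Space n →L[ℝ] Space n} (hS : S.det ≠ 0) {c x : Space n}
    (hx : S x + c = 0) (B : Set (Space n)) :
    volume ((fun y => S y + c) ⁻¹' B) = ENNReal.ofReal |S.det|⁻¹ * volume B := by
  rw [preimage_affine_eq_image hS hx]
  refine (volume_image_affine _ _ _).trans ?_
  set E := S.toContinuousLinearEquivOfDetNeZero hS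
  have h1 : (E.symm : Space n →L[ℝ] Space n).det * S.det = 1 := by
    rw [← det_comp_eq, show (E.symm : Space n →L[ℝ] Space n) ∘L S = ContinuousLinearMap.id ℝ _ from
      ContinuousLinearMap.ext E.symm_apply_apply]
    simp [ContinuousLinearMap.det]
  rw [eq_inv_of_mul_eq_one_left h1, abs_inv]

theorem ofReal_mul_volume_closedBall_le {a b : ℝ} (hb : 0 ≤ b) :
    ENNReal.ofReal a * volume (closedBall (0 : Space n) 1) ≤
      ENNReal.ofReal b * volume (closedBall (0 : Space n) 1) ↔ a ≤ b := by
  rw [ENNReal.mul_le_mul_iff_left (measure_closedBall_pos volume _ one_pos).ne'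
    measure_closedBall_lt_top.ne, ENNReal.ofReal_le_ofReal_iff hb]

theorem isJohnEllipsoid_image_iff {K : Body n} {T : Space n →L[ℝ] Space n} (hT : T.det ≠ 0)
    (c : Space n) : IsJohnEllipsoid K ((fun y => T y + c) '' closedBall 0 1) ↔
      IsMaxAffine (closedBall 0 1) K.toSet T c := by
  constructor
  · rintro ⟨-, hsub, hmax⟩
    refine ⟨fun x hx => hsub (mem_image_of_mem _ hx), fun T' c' h' => ?_⟩
    rcases eq_or_ne T'.det 0 with h0 | h0
    · simp [h0]
    have := hmax _ ⟨c', isEllipsoidWithCenter_iff.2 ⟨T', h0, rfl⟩⟩ (image_subset_iff.2 h')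
    rwa [volume_image_affine, volume_image_affine,
      ofReal_mul_volume_closedBall_le (abs_nonneg _)] at this
  · intro h
    refine ⟨⟨c, isEllipsoidWithCenter_iff.2 ⟨T, hT, rfl⟩⟩, image_subset_iff.2 h.mapsTo, ?_⟩
    rintro F ⟨c', hc'⟩ hF
    obtain ⟨T', hT', rfl⟩ := isEllipsoidWithCenter_iff.1 hc'
    rw [volume_image_affine, volume_image_affine, ofReal_mul_volume_closedBall_le (abs_nonneg _)]
    exact h.abs_det_le _ _ (image_subset_iff.1 hF)

theorem isLoewnerEllipsoid_preimage_iff {K : Body n} {S : Space n →L[ℝ] Space n}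
    (hS : S.det ≠ 0) {c x : Space n} (hx : S x + c = 0) :
    IsLoewnerEllipsoid K ((fun y => S y + c) ⁻¹' closedBall 0 1) ↔
      IsMaxAffine K.toSet (closedBall 0 1) S c := by
  constructor
  · rintro ⟨-, hsub, hmin⟩
    refine ⟨hsub, fun S' c' h' => ?_⟩
    rcases eq_or_ne S'.det 0 with h0 | h0
    · simp [h0]
    have hx' : S' ((S'.toContinuousLinearEquivOfDetNeZero h0).symm (-c')) + c' = 0 := by
      rw [show S' ((S'.toContinuousLinearEquivOfDetNeZero h0).symm (-c')) = -c' from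
        (S'.toContinuousLinearEquivOfDetNeZero h0).apply_symm_apply _, neg_add_cancel]
    have := hmin _ ⟨_, isEllipsoidWithCenter_iff_preimage.2 ⟨S', c', h0, hx', rfl⟩⟩ h'
    rwa [volume_preimage_affine hS hx, volume_preimage_affine h0 hx',
      ofReal_mul_volume_closedBall_le (inv_nonneg.2 (abs_nonneg _)),
      inv_le_inv₀ (abs_pos.2 hS) (abs_pos.2 h0)] at this
  · intro h
    refine ⟨⟨x, isEllipsoidWithCenter_iff_preimage.2 ⟨S, c, hS, hx, rfl⟩⟩, h.mapsTo, ?_⟩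
    rintro F ⟨x', hF⟩ hKF
    obtain ⟨S', c', hS', hx', rfl⟩ := isEllipsoidWithCenter_iff_preimage.1 hF
    rw [volume_preimage_affine hS hx, volume_preimage_affine hS' hx',
      ofReal_mul_volume_closedBall_le (inv_nonneg.2 (abs_nonneg _)),
      inv_le_inv₀ (abs_pos.2 hS) (abs_pos.2 hS')]
    exact h.abs_det_le _ _ hKF

theorem interior_closedBall_nonempty : (interior (closedBall (0 : Space n) 1)).Nonempty :=
  ⟨0, ball_subset_interior_closedBall (mem_ball_self one_pos)⟩

theorem IsMaxAffine.john_det_ne_zero {K : Body n} {T : Space n →L[ℝ] Space n} {c : Space n}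
    (h : IsMaxAffine (closedBall 0 1) K.toSet T c) : T.det ≠ 0 :=
  h.det_ne_zero isBounded_closedBall K.2

theorem IsMaxAffine.loewner_det_ne_zero {K : Body n} {S : Space n →L[ℝ] Space n} {c : Space n}
    (h : IsMaxAffine K.toSet (closedBall 0 1) S c) : S.det ≠ 0 :=
  h.det_ne_zero K.isCompact.isBounded interior_closedBall_nonempty

theorem isJohnPoint_iff {K : Body n} {x : Space n} :
    IsJohnPoint K x ↔ ∃ T, IsMaxAffine (closedBall 0 1) K.toSet T x := by
  constructor
  · rintro ⟨E, hE, hEx⟩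
    obtain ⟨T, hT, rfl⟩ := isEllipsoidWithCenter_iff.1 hEx
    exact ⟨T, (isJohnEllipsoid_image_iff hT x).1 hE⟩
  · rintro ⟨T, h⟩
    exact ⟨_, (isJohnEllipsoid_image_iff h.john_det_ne_zero x).2 h,
      isEllipsoidWithCenter_iff.2 ⟨T, h.john_det_ne_zero, rfl⟩⟩

theorem isLoewnerPoint_iff {K : Body n} {x : Space n} :
    IsLoewnerPoint K x ↔
      ∃ S c, IsMaxAffine K.toSet (closedBall 0 1) S c ∧ S x + c = 0 := by
  constructor
  · rintro ⟨E, hE, hEx⟩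
    obtain ⟨S, c, hS, hx, rfl⟩ := isEllipsoidWithCenter_iff_preimage.1 hEx
    exact ⟨S, c, (isLoewnerEllipsoid_preimage_iff hS hx).1 hE, hx⟩
  · rintro ⟨S, c, h, hx⟩
    exact ⟨_, (isLoewnerEllipsoid_preimage_iff h.loewner_det_ne_zero hx).2 h,
      isEllipsoidWithCenter_iff_preimage.2 ⟨S, c, h.loewner_det_ne_zero, hx, rfl⟩⟩

theorem IsJohnEllipsoid.unique {K : Body n} {E F : Set (Space n)} (hE : IsJohnEllipsoid K E)
    (hF : IsJohnEllipsoid K F) : E = F := by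
  obtain ⟨c, hc⟩ := hE.1
  obtain ⟨c', hc'⟩ := hF.1
  obtain ⟨T, hT, rfl⟩ := isEllipsoidWithCenter_iff.1 hc
  obtain ⟨T', hT', rfl⟩ := isEllipsoidWithCenter_iff.1 hc'
  obtain ⟨rfl, h⟩ := ((isJohnEllipsoid_image_iff hT c).1 hE).image_closedBall_unique K.convex
    ((isJohnEllipsoid_image_iff hT' c').1 hF) hT
  rw [← image_image (· + c) T, ← image_image (· + c) T', h]

theorem IsLoewnerEllipsoid.unique {K : Body n} {E F : Set (Space n)}
    (hE : IsLoewnerEllipsoid K E) (hF : IsLoewnerEllipsoid K F) : E = F := by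
  obtain ⟨x, hx⟩ := hE.1
  obtain ⟨x', hx'⟩ := hF.1
  obtain ⟨S, c, hS, h, rfl⟩ := isEllipsoidWithCenter_iff_preimage.1 hx
  obtain ⟨S', c', hS', h', rfl⟩ := isEllipsoidWithCenter_iff_preimage.1 hx'
  have := ((isLoewnerEllipsoid_preimage_iff hS h).1 hE).norm_unique
    ((isLoewnerEllipsoid_preimage_iff hS' h').1 hF) hS
  ext y
  simp [this y]

theorem IsJohnPoint.unique {K : Body n} {x y : Space n} (hx : IsJohnPoint K x)
    (hy : IsJohnPoint K y) : x = y := by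
  obtain ⟨T, hT⟩ := isJohnPoint_iff.1 hx
  obtain ⟨T', hT'⟩ := isJohnPoint_iff.1 hy
  exact (hT.image_closedBall_unique K.convex hT' hT.john_det_ne_zero).1

theorem IsLoewnerPoint.unique {K : Body n} {x y : Space n} (hx : IsLoewnerPoint K x)
    (hy : IsLoewnerPoint K y) : x = y := by
  obtain ⟨S, c, hS, hxc⟩ := isLoewnerPoint_iff.1 hx
  obtain ⟨S', c', hS', hyc⟩ := isLoewnerPoint_iff.1 hy
  have h0 : S y + c = 0 := by
    rw [← norm_eq_zero, hS.norm_unique hS' hS.loewner_det_ne_zero, hyc, norm_zero]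
  exact (S.toContinuousLinearEquivOfDetNeZero hS.loewner_det_ne_zero).injective
    (add_right_cancel (hxc.trans h0.symm))

theorem isJohnPoint_johnPoint (K : Body n) : IsJohnPoint K (johnPoint K) := by
  obtain ⟨T, c, h⟩ := exists_isMaxAffine interior_closedBall_nonempty K.isCompact K.1.nonempty
  exact Classical.epsilon_spec ⟨c, isJohnPoint_iff.2 ⟨T, h⟩⟩

theorem isLoewnerPoint_loewnerPoint (K : Body n) : IsLoewnerPoint K (loewnerPoint K) := by
  obtain ⟨S, c, h⟩ := exists_isMaxAffine K.2 (isCompact_closedBall (0 : Space n) 1)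
    ⟨0, by simp⟩
  exact Classical.epsilon_spec (p := IsLoewnerPoint K)
    ⟨(S.toContinuousLinearEquivOfDetNeZero h.loewner_det_ne_zero).symm (-c),
    isLoewnerPoint_iff.2 ⟨S, c, h, by
      rw [show S ((S.toContinuousLinearEquivOfDetNeZero h.loewner_det_ne_zero).symm (-c)) = -c from
        (S.toContinuousLinearEquivOfDetNeZero _).apply_symm_apply _, neg_add_cancel]⟩⟩

theorem isJohnPoint_iff_eq {K : Body n} {x : Space n} : IsJohnPoint K x ↔ x = johnPoint K :=
  ⟨fun h => h.unique (isJohnPoint_johnPoint K), fun h => h ▸ isJohnPoint_johnPoint K⟩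

theorem isLoewnerPoint_iff_eq {K : Body n} {x : Space n} :
    IsLoewnerPoint K x ↔ x = loewnerPoint K :=
  ⟨fun h => h.unique (isLoewnerPoint_loewnerPoint K), fun h => h ▸ isLoewnerPoint_loewnerPoint K⟩

end Ellipsoids

/-! ### The John and Löwner points -/

section AffineInvariance

variable {n : ℕ}

theorem isProper_johnPoint : IsProper (johnPoint (n := n)) := by
  intro K
  obtain ⟨T, hT⟩ := isJohnPoint_iff.1 (isJohnPoint_johnPoint K)
  set E := T.toContinuousLinearEquivOfDetNeZero hT.john_det_ne_zero
  refine mem_interior.2 ⟨(fun y => E.symm (y - johnPoint K)) ⁻¹' ball 0 1, fun y hy => ?_,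
    isOpen_ball.preimage (by fun_prop), by simp⟩
  have h := hT.mapsTo _ (ball_subset_closedBall hy)
  rwa [show T (E.symm (y - johnPoint K)) = y - johnPoint K from E.apply_symm_apply _,
    sub_add_cancel] at h

theorem isProper_loewnerPoint : IsProper (loewnerPoint (n := n)) := by
  intro K
  obtain ⟨S, c, hS, hc⟩ := isLoewnerPoint_iff.1 (isLoewnerPoint_loewnerPoint K)
  exact hS.mem_interior K.convex K.2 hS.loewner_det_ne_zero hc

theorem continuous_johnPoint : Continuous (johnPoint (n := n)) := by
  rw [continuous_iff_continuousAt]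
  intro K
  choose T hT using fun K : Body n => isJohnPoint_iff.1 (isJohnPoint_johnPoint K)
  rw [ContinuousAt, tendsto_iff_ultrafilter]
  intro g hg
  obtain ⟨y₀, hy₀⟩ := K.2
  have hY := (K.homotheticLimit hy₀).comp (f := (g : Filter (Body n))) (u := id) hg
  have hX := homotheticLimit_closedBall (n := n) (g : Filter (Body n))
  obtain ⟨T₀, c₀, hT₀, hc₀⟩ := hX.exists_tendsto hY interior_closedBall_nonempty K.isCompact
    fun i => (hT i).mapsTo
  have h := IsMaxAffine.of_tendsto hX hY K.isCompact.isClosed hT₀ hc₀ hT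
  rwa [isJohnPoint_iff_eq.1 (isJohnPoint_iff.2 ⟨T₀, h⟩)] at hc₀

theorem continuous_loewnerPoint : Continuous (loewnerPoint (n := n)) := by
  rw [continuous_iff_continuousAt]
  intro K
  choose S c hS hc using fun K : Body n => isLoewnerPoint_iff.1 (isLoewnerPoint_loewnerPoint K)
  rw [ContinuousAt, tendsto_iff_ultrafilter]
  intro g hg
  obtain ⟨x₀, hx₀⟩ := K.2
  have hX := (K.homotheticLimit hx₀).comp (f := (g : Filter (Body n))) (u := id) hg
  have hY := homotheticLimit_closedBall (n := n) (g : Filter (Body n))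
  obtain ⟨S₀, c₀, hS₀, hc₀⟩ := hX.exists_tendsto hY K.2 (isCompact_closedBall 0 1)
    fun i => (hS i).mapsTo
  have h := IsMaxAffine.of_tendsto hX hY isClosed_closedBall hS₀ hc₀ hS
  -- The centers stay bounded because they lie in the bodies, so they converge along `g`.
  have hev : ∀ᶠ L in (g : Filter (Body n)), x₀ + (1 / 2 : ℝ) • (loewnerPoint L - x₀) ∈ K.toSet := by
    filter_upwards [hX (1 / 2) (by norm_num)] with L hL
    exact hL.2 _ (interior_subset (isProper_loewnerPoint L))
  obtain ⟨w, -, hw⟩ := K.isCompact.ultrafilter_le_nhds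
    (g.map fun L => x₀ + (1 / 2 : ℝ) • (loewnerPoint L - x₀))
    (le_principal_iff.2 hev)
  have hw' : Tendsto (fun L => x₀ + (1 / 2 : ℝ) • (loewnerPoint L - x₀)) g (𝓝 w) := hw
  have hlim : Tendsto loewnerPoint g (𝓝 ((2 : ℝ) • (w - x₀) + x₀)) := by
    convert ((hw'.sub_const x₀).const_smul (2 : ℝ)).add_const x₀ using 2 with L
    module
  have h0 : S₀ ((2 : ℝ) • (w - x₀) + x₀) + c₀ = 0 := by
    have happ : Tendsto (fun L => S L (loewnerPoint L)) g (𝓝 (S₀ ((2 : ℝ) • (w - x₀) + x₀))) :=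
      ((isBoundedBilinearMap_apply (𝕜 := ℝ)).continuous.tendsto (S₀, _)).comp
        (hS₀.prodMk_nhds hlim)
    refine tendsto_nhds_unique (happ.add hc₀) ?_
    simp_rw [hc]
    exact tendsto_const_nhds
  rwa [isLoewnerPoint_iff_eq.1 (isLoewnerPoint_iff.2 ⟨S₀, c₀, h, h0⟩)] at hlim

theorem exists_affineEquiv_apply_eq (T : Space n ≃ᵃ[ℝ] Space n) :
    ∃ (A : Space n ≃L[ℝ] Space n) (a : Space n), ∀ x, T x = A x + a := by
  refine ⟨T.linear.toContinuousLinearEquiv, T 0, fun x => ?_⟩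
  simpa using T.map_vadd 0 x

theorem isAffineInvariantPoint_johnPoint : IsAffineInvariantPoint (johnPoint (n := n)) := by
  refine ⟨continuous_johnPoint, fun T K => ?_⟩
  obtain ⟨A, a, hA⟩ := exists_affineEquiv_apply_eq T
  obtain ⟨S, hS⟩ := isJohnPoint_iff.1 (isJohnPoint_johnPoint K)
  have h := hS.image_right A a
  rw [← hA, ← show T '' K.toSet = (fun y => A y + a) '' K.toSet from image_congr fun y _ => hA y]
    at h
  exact (isJohnPoint_iff_eq.1 (isJohnPoint_iff.2 ⟨_, h⟩)).symm

theorem isAffineInvariantPoint_loewnerPoint :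
    IsAffineInvariantPoint (loewnerPoint (n := n)) := by
  refine ⟨continuous_loewnerPoint, fun T K => ?_⟩
  obtain ⟨A, a, hA⟩ := exists_affineEquiv_apply_eq T.symm
  obtain ⟨S, c, hS, hc⟩ := isLoewnerPoint_iff.1 (isLoewnerPoint_loewnerPoint K)
  have h := hS.preimage_left A a
  rw [← show (K.image T).toSet = (fun y => A y + a) ⁻¹' K.toSet by
    simp_rw [← hA]
    exact T.toEquiv.image_eq_preimage_symm K.toSet] at h
  refine (isLoewnerPoint_iff_eq.1 (isLoewnerPoint_iff.2 ⟨_, _, h, ?_⟩)).symm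
  rw [ContinuousLinearMap.comp_apply, ← add_assoc, ← map_add]
  change S (A (T (loewnerPoint K)) + a) + c = 0
  rw [← hA, T.symm_apply_apply, hc]

theorem loewnerPoint_polar_johnPoint (K : Body n) :
    loewnerPoint (K.polar (johnPoint K) (isProper_johnPoint K)) = johnPoint K := by
  obtain ⟨T, hT⟩ := isJohnPoint_iff.1 (isJohnPoint_johnPoint K)
  have h : IsMaxAffine (K.polar _ (isProper_johnPoint K)).toSet (closedBall 0 1) _ _ :=
    hT.polar_of_john K.convex K.isCompact (interior_subset (isProper_johnPoint K))
  exact (isLoewnerPoint_iff_eq.1 (isLoewnerPoint_iff.2 ⟨_, _, h, add_neg_cancel _⟩)).symm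

theorem johnPoint_polar_loewnerPoint (L : Body n) :
    johnPoint (L.polar (loewnerPoint L) (isProper_loewnerPoint L)) = loewnerPoint L := by
  obtain ⟨S, c, hS, hc⟩ := isLoewnerPoint_iff.1 (isLoewnerPoint_loewnerPoint L)
  have h : IsMaxAffine (closedBall 0 1) (L.polar _ (isProper_loewnerPoint L)).toSet _ _ :=
    hS.polar_of_loewner hS.loewner_det_ne_zero hc
  exact (isJohnPoint_iff_eq.1 (isJohnPoint_iff.2 ⟨_, h⟩)).symm

theorem isDual_loewnerPoint_johnPoint :
    IsDual (loewnerPoint (n := n)) (johnPoint (n := n)) :=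
  ⟨isAffineInvariantPoint_johnPoint, isAffineInvariantPoint_loewnerPoint, isProper_johnPoint,
    loewnerPoint_polar_johnPoint⟩

/-- Each convex body `L` is the polar of a body `K` with respect to the John point of `K`, namely of
`K = L^{l(L)}`; hence the John point has only one dual. -/
theorem IsDual.eq_loewnerPoint {q : Body n → Space n} (hq : IsDual q johnPoint) :
    q = loewnerPoint := by
  obtain ⟨-, -, hp, hq⟩ := hq
  funext L
  have hj := johnPoint_polar_loewnerPoint L
  set K := L.polar (loewnerPoint L) (isProper_loewnerPoint L)
  have hKL : K.polar (johnPoint K) (hp K) = L := by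
    refine Subtype.ext (ConvexBody.ext ?_)
    change polarSet (polarSet L.toSet (loewnerPoint L)) (johnPoint K) = L.toSet
    rw [hj]
    exact polarSet_polarSet L.convex L.isCompact.isClosed
      (interior_subset (isProper_loewnerPoint L))
  rw [← hj, ← hq K, hKL]

end AffineInvariance

end AffInv

/-- Each convex body has exactly one John ellipsoid and exactly one Löwner ellipsoid, `johnPoint`
and `loewnerPoint` are their well-defined centers, both are affine invariant points, and
`loewnerPoint` is the dual (that is, a dual, and the only one) of `johnPoint`. -/
theorem mainTheorem7 (n : ℕ) :
    (∀ K : AffInv.Body n,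
      (∃! E, AffInv.IsJohnEllipsoid K E) ∧ (∃! E, AffInv.IsLoewnerEllipsoid K E) ∧
      (∀ x, AffInv.IsJohnPoint K x ↔ x = AffInv.johnPoint K) ∧
      (∀ x, AffInv.IsLoewnerPoint K x ↔ x = AffInv.loewnerPoint K)) ∧
    AffInv.IsAffineInvariantPoint (AffInv.johnPoint (n := n)) ∧
    AffInv.IsAffineInvariantPoint (AffInv.loewnerPoint (n := n)) ∧
    AffInv.IsDual (AffInv.loewnerPoint (n := n)) (AffInv.johnPoint (n := n)) ∧
    ∀ q : AffInv.Body n → AffInv.Space n,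
      AffInv.IsDual q AffInv.johnPoint → q = AffInv.loewnerPoint := by
  refine ⟨fun K => ⟨?_, ?_, fun x => AffInv.isJohnPoint_iff_eq,
    fun x => AffInv.isLoewnerPoint_iff_eq⟩, AffInv.isAffineInvariantPoint_johnPoint,
    AffInv.isAffineInvariantPoint_loewnerPoint, AffInv.isDual_loewnerPoint_johnPoint,
    fun q hq => hq.eq_loewnerPoint⟩
  · obtain ⟨E, hE, -⟩ := AffInv.isJohnPoint_johnPoint K
    exact ⟨E, hE, fun F hF => hF.unique hE⟩
  · obtain ⟨E, hE, -⟩ := AffInv.isLoewnerPoint_loewnerPoint K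
    exact ⟨E, hE, fun F hF => hF.unique hE⟩
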